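/- Work and depth are measured in the work-depth model: a parallel language on a word RAM with concurrent reads and writes and parallel loops, in which the work is the number of operations and the depth the number of parallel time steps; the word length on inputs of length $n$ is any $w(n)\ge 4(\lfloor\log n\rfloor+1)$, and memory is unrestricted. Logarithms are to base 2. For a sequence $S$ of length $n$ over the alphabet $\{0,\dots,\sigma-1\}$, $2\le\sigma\le n$, put $L=\lceil\log\sigma\rceil$. The wavelet tree of $S$ is the binary tree whose root represents the symbols $[0,2^L-1]$ and holds all of $S$; a node that represents $[a,a+2^k-1]$, $k\ge 1$, and holds the (non-empty) subsequence of the symbols of $S$ in this range stores a bitmap with one bit for each of them, namely $0$ if the symbol is below $a+2^{k-1}$ and $1$ otherwise; its left and right children represent $[a,a+2^{k-1}-1]$ and $[a+2^{k-1},a+2^k-1]$, and there are no nodes for ranges of one symbol or without symbols of $S$. Algorithm sortWT processes all levels $l=0,\dots,L-1$ in parallel. On level $l$ it stably sorts $S$ by the top $l$ of the $L$ bits of each symbol (no sorting for $l=0$), using a given stable integer sort as a subroutine, writes the $(l+1)$-st highest bits of the sorted sequence to a bitmap of length $n$, finds by a filter (implemented by a prefix sum) the positions at which the top $l$ bits change,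 and stores for each node of the level, under the identifier $2^l-1+(\text{top } l \text{ bits})$, the start and the length of its bitmap within the bitmap of the level. **Theorem.** Let $A$ be a program for stable sorting of $n$ records with integer keys in $[0,n)$ (and satellite values in $[0,n)$). 1. If $A$ always sorts correctly, with $O(n\log\log n)$ work and $O(\log n/\log\log n)$ depth, then sortWT with the sort $A$ always constructs the wavelet tree of $S$, with $O(n\log\log n\log\sigma)$ work and $O(\log n)$ depth, for every alphabet size $2\le\sigma\le n$ and with constants that do not depend on $\sigma$ and $S$. (This covers deterministic sorts, including those that use super-linear space.) 2. If $A$ is randomized and, on every input of $n$ records, with probability at least $1-\delta(n)$ it sorts correctly and within $O(n\log\log n)$ work and $O(\log n/\log\log n)$ depth, then for every such $S$, with probability at least $1-\lceil\log\sigma\rceil\,\delta(n)$, sortWT with the sort $A$ constructs the wavelet tree of $S$ with $O(n\log\log n\log\sigma)$ work and $O(\log n)$ depth, again with constants that do not depend on $\sigma$ and $S$. (In all $O$-bounds, $n\to\infty$; correctness holds for all $n$.) -/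

import Mathlib

open MeasureTheory

open scoped ENNReal

namespace WorkDepth

/-! ### The work-depth model

A small parallel language over a word RAM with concurrent reads and writes.  The word length `w`
and a tape `ω` of random words are parameters of its semantics. -/

/-- The unit-cost word operations. -/
inductive Op
  | add | sub | mul | div | mod | shl | shr | land | lor | xor | lt | eq

/-- Word operations on natural numbers; `sub` is truncated, `lt` and `eq` return `0` or `1`. -/
def Op.eval : Op → ℕ → ℕ → ℕ
  | .add, a, b => a + b
  | .sub, a, b => a - b
  | .mul, a, b => a * b
  | .div, a, b => a / b
  | .mod, a, b => a % b
  | .shl, a, b => a <<< b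
  | .shr, a, b => a >>> b
  | .land, a, b => a &&& b
  | .lor, a, b => a ||| b
  | .xor, a, b => a ^^^ b
  | .lt, a, b => if a < b then 1 else 0
  | .eq, a, b => if a = b then 1 else 0

/-- Expressions: constants, registers, binary operations, reads `a[r][i]` of shared memory, and
words of the random tape. -/
inductive Expr
  | lit (k : ℕ)
  | reg (x : ℕ)
  | op (o : Op) (e f : Expr)
  | read (a : ℕ) (r i : Expr)
  | rnd (e : Expr)

instance (k : ℕ) : OfNat Expr k := ⟨.lit k⟩
instance : Add Expr := ⟨.op .add⟩
instance : Sub Expr := ⟨.op .sub⟩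
instance : Mul Expr := ⟨.op .mul⟩
instance : Div Expr := ⟨.op .div⟩
instance : HShiftLeft Expr Expr Expr := ⟨.op .shl⟩
instance : HShiftRight Expr Expr Expr := ⟨.op .shr⟩
instance : HAnd Expr Expr Expr := ⟨.op .land⟩

/-- Shared memory: `m a r i` is the word in row `r`, position `i` of the array named `a`. -/
abbrev Mem := ℕ → ℕ → ℕ → ℕ

/-- A state consists of the (private) registers and the (shared) memory. -/
structure State where
  reg : ℕ → ℕ
  mem : Mem

/-- Assign a register. -/
def State.setReg (s : State) (x v : ℕ) : State := { s with reg := Function.update s.reg x v }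

/-- Assign a memory cell. -/
def State.setMem (s : State) (a r i v : ℕ) : State :=
  { s with mem := fun a' r' i' => if a' = a ∧ r' = r ∧ i' = i then v else s.mem a' r' i' }

/-- The value of an expression; arithmetic is modulo `2 ^ w`. -/
def Expr.eval (w : ℕ) (ω : ℕ → Fin (2 ^ w)) (s : State) : Expr → ℕ
  | .lit k => k % 2 ^ w
  | .reg x => s.reg x
  | .op o e f => o.eval (e.eval w ω s) (f.eval w ω s) % 2 ^ w
  | .read a r i => s.mem a (r.eval w ω s) (i.eval w ω s)
  | .rnd e => ω (e.eval w ω s)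

/-- The number of unit-cost operations in an expression. -/
def Expr.size : Expr → ℕ
  | .lit _ => 1
  | .reg _ => 1
  | .op _ e f => e.size + f.size + 1
  | .read _ r i => r.size + i.size + 1
  | .rnd e => e.size + 1

/-- Programs.  `par x e c` is the parallel loop that runs `c` for all values `0, …, e - 1` of the
register `x` at the same time.  `call p n ka kr va vr oa or` calls the subroutine `p` on the
`n` keys `ka[kr][0..n-1]` and the `n` values `va[vr][0..n-1]` and stores the `n` words that it
returns in `oa[or][0..n-1]`. -/
inductive Cmd
  | skip
  | set (x : ℕ) (e : Expr)
  | write (a : ℕ) (r i e : Expr)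
  | seq (c d : Cmd)
  | ite (e : Expr) (c d : Cmd)
  | while (e : Expr) (c : Cmd)
  | par (x : ℕ) (e : Expr) (c : Cmd)
  | call (p : Cmd) (n : Expr) (ka : ℕ) (kr : Expr) (va : ℕ) (vr : Expr) (oa : ℕ) (or : Expr)

/-- Sequential composition of a list of commands. -/
def block : List Cmd → Cmd
  | [] => .skip
  | [c] => c
  | c :: cs => .seq c (block cs)

/-- The result of a terminating run: final state, number of operations, number of time steps. -/
structure Outcome where
  state : State
  work : ℕ
  depth : ℕ

/-- Add `k` sequential operations to the cost of a run. -/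
def Outcome.charge (k : ℕ) (o : Outcome) : Outcome := ⟨o.state, k + o.work, k + o.depth⟩

/-- Memory after `k` parallel iterations which started from memory `m₀` and ended with memories
`m 0, …, m (k - 1)`: a cell receives the value of an iteration that changed it.  If there are
several (a concurrent write), the one of least index wins. -/
def mergeMem (k : ℕ) (m₀ : Mem) (m : ℕ → Mem) : Mem := fun a r i =>
  match (List.range k).find? (fun j => m j a r i ≠ m₀ a r i) with
  | some j => m j a r i
  | none => m₀ a r i

/-- The initial state of a sorting program: the number `n` of records in register `0`, their keys
in `0[0][0..n-1]`, their values in `1[0][0..n-1]`, and zeros elsewhere. -/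
def sortInput (n : ℕ) (key val : ℕ → ℕ) : State where
  reg := fun x => if x = 0 then n else 0
  mem := fun a r i =>
    if a = 0 ∧ r = 0 ∧ i < n then key i else if a = 1 ∧ r = 0 ∧ i < n then val i else 0

/-- Iterate `body` while `test` is not zero, at most `fuel` times; each test costs `k`. -/
def whileLoop (test : State → ℕ) (k : ℕ) (body : State → Option Outcome) :
    ℕ → State → Option Outcome
  | 0, s => if test s = 0 then some ⟨s, k, k⟩ else none
  | fuel + 1, s =>
    if test s = 0 then some ⟨s, k, k⟩
    else (body s).bind fun o =>
      (whileLoop test k body fuel o.state).map fun o' =>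
        ⟨o'.state, k + o.work + o'.work, k + o.depth + o'.depth⟩

/-- The semantics of programs, with the number of operations (work) and of time steps (depth).
Sequential composition adds both; a parallel loop adds the works of its iterations and takes the
maximum of their depths.  Every iteration starts from the memory at the fork and from a private
copy of the registers, which is discarded at the join.  A subroutine runs in a memory of its own;
passing its input and output costs one parallel step with three operations per record.
The result is `none` if some loop is not finished after `fuel` iterations. -/
def run (w : ℕ) (ω : ℕ → Fin (2 ^ w)) (fuel : ℕ) : Cmd → State → Option Outcome
  | .skip, s => some ⟨s, 1, 1⟩
  | .set x e, s => some ⟨s.setReg x (e.eval w ω s), 1 + e.size, 1 + e.size⟩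
  | .write a r i e, s =>
    some ⟨s.setMem a (r.eval w ω s) (i.eval w ω s) (e.eval w ω s),
      1 + r.size + i.size + e.size, 1 + r.size + i.size + e.size⟩
  | .seq c d, s =>
    (run w ω fuel c s).bind fun o =>
      (run w ω fuel d o.state).map fun o' =>
        ⟨o'.state, o.work + o'.work, o.depth + o'.depth⟩
  | .ite e c d, s =>
    (if e.eval w ω s ≠ 0 then run w ω fuel c s else run w ω fuel d s).map
      (Outcome.charge (1 + e.size))
  | .while e c, s =>
    whileLoop (fun s => e.eval w ω s) (1 + e.size) (fun s => run w ω fuel c s) fuel s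
  | .par x e c, s =>
    let k := e.eval w ω s
    let o : ℕ → Option Outcome := fun j => run w ω fuel c (s.setReg x j)
    if ∀ j < k, (o j).isSome then
      let o' : ℕ → Outcome := fun j => (o j).getD ⟨s, 0, 0⟩
      some ⟨⟨s.reg, mergeMem k s.mem (fun j => (o' j).state.mem)⟩,
        1 + e.size + ∑ j ∈ Finset.range k, (1 + (o' j).work),
        1 + e.size + (Finset.range k).sup (fun j => 1 + (o' j).depth)⟩
    else none
  | .call p n ka kr va vr oa or, s =>
    let len := n.eval w ω s
    let k := 1 + n.size + kr.size + vr.size + or.size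
    (run w ω fuel p (sortInput len (s.mem ka (kr.eval w ω s)) (s.mem va (vr.eval w ω s)))).map
      fun o =>
        ⟨⟨s.reg, fun a r i =>
            if a = oa ∧ r = or.eval w ω s ∧ i < len then o.state.mem 2 0 i else s.mem a r i⟩,
          k + 3 * len + o.work, k + 1 + o.depth⟩

/-- The tape of independent uniformly random words of length `w`. -/
noncomputable def tape (w : ℕ) : Measure (ℕ → Fin (2 ^ w)) :=
  Measure.infinitePi fun _ => (PMF.uniformOfFintype (Fin (2 ^ w))).toMeasure

/-! ### Stable integer sorting -/

/-- `out 0, …, out (n - 1)` are the values of the records `(key i, val i)`, `i < n`, listed in the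
order of their keys, records with equal keys in their original order. -/
def IsStableSort (n : ℕ) (key val out : ℕ → ℕ) : Prop :=
  ∃ π : List ℕ, π.Perm (List.range n) ∧
    π.Pairwise (fun i j => key i < key j ∨ (key i = key j ∧ i < j)) ∧
    (List.range n).map out = π.map val

/-- On the given records and random tape, the program `P` halts and leaves in `2[0][0..n-1]` the
stably sorted values; if `n ≥ n₀`, this takes at most `C * n * log log n` work and
`C * log n / log log n` depth. -/
def SortsWithin (w : ℕ) (ω : ℕ → Fin (2 ^ w)) (P : Cmd) (C : ℝ) (n₀ n : ℕ) (key val : ℕ → ℕ) :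
    Prop :=
  ∃ fuel o, run w ω fuel P (sortInput n key val) = some o ∧
    IsStableSort n key val (o.state.mem 2 0) ∧
    (n₀ ≤ n →
      (o.work : ℝ) ≤ C * (n * Real.logb 2 (Real.logb 2 n)) ∧
      (o.depth : ℝ) ≤ C * (Real.logb 2 n / Real.logb 2 (Real.logb 2 n)))

/-! ### Wavelet trees -/

/-- Binary trees with a bitmap in every node. -/
inductive WTree
  | empty
  | node (bitmap : List Bool) (left right : WTree)

/-- The wavelet tree of a sequence `s` of symbols from the range `a, …, a + 2 ^ k - 1`.  A bit is
set if the symbol lies in the upper half of the range.  There is no node for a range of one symbol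
and none for the empty sequence. -/
def waveletTree : ℕ → ℕ → List ℕ → WTree
  | 0, _, _ => .empty
  | k + 1, a, s =>
    if s = [] then .empty
    else .node (s.map fun c => decide (a + 2 ^ k ≤ c))
      (waveletTree k a (s.filter fun c => c < a + 2 ^ k))
      (waveletTree k (a + 2 ^ k) (s.filter fun c => a + 2 ^ k ≤ c))

/-! ### The algorithm

Arrays: the input sequence `S[0]`; for each level `l` a bitmap `B[l]`; the nodes' bitmap pointers
`Ptr[0]` and bitmap lengths `Len[0]`; and, for each level, the keys `K[l]`, the sorted sequence
`S'[l]`, the trees `T[l]` and `Q[l]` of the prefix sum, and the filtered indices `O[l]`. -/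

namespace Arr
abbrev S : ℕ := 0
abbrev B : ℕ := 1
abbrev Ptr : ℕ := 2
abbrev Len : ℕ := 3
abbrev K : ℕ := 4
abbrev S' : ℕ := 5
abbrev T : ℕ := 6
abbrev Q : ℕ := 7
abbrev O : ℕ := 8
end Arr

/-- The memory `m` holds the tree, whose root has level `l` and identifier `id`: the length of
the node's bitmap is `Len[0][id]`, the bitmap is the segment of `B[l]` that starts at position
`Ptr[0][id]`, and the children have identifiers `2 * id + 1` and `2 * id + 2`.  Length `0` means
that there is no node. -/
def StoresTree (m : Mem) : ℕ → ℕ → WTree → Prop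
  | _, id, .empty => m Arr.Len 0 id = 0
  | l, id, .node bitmap left right =>
    m Arr.Len 0 id = bitmap.length ∧
    (List.range bitmap.length).map (fun j => m Arr.B l (m Arr.Ptr 0 id + j)) =
      bitmap.map Bool.toNat ∧
    StoresTree m (l + 1) (2 * id + 1) left ∧
    StoresTree m (l + 1) (2 * id + 2) right

/-! The registers of the algorithm (`Reg.x`) and their values (`x`). -/

namespace Reg
abbrev n : ℕ := 0
abbrev σ : ℕ := 1
abbrev L : ℕ := 2
abbrev l : ℕ := 3
abbrev mask : ℕ := 4
abbrev i : ℕ := 5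
abbrev pow : ℕ := 6
abbrev N : ℕ := 7
abbrev m : ℕ := 8
abbrev cnt : ℕ := 9
abbrev node : ℕ := 10
end Reg

namespace SortWT

abbrev n : Expr := .reg Reg.n
abbrev σ : Expr := .reg Reg.σ
abbrev L : Expr := .reg Reg.L
abbrev l : Expr := .reg Reg.l
abbrev mask : Expr := .reg Reg.mask
abbrev i : Expr := .reg Reg.i
abbrev pow : Expr := .reg Reg.pow
abbrev N : Expr := .reg Reg.N
abbrev m : Expr := .reg Reg.m
abbrev cnt : Expr := .reg Reg.cnt
abbrev node : Expr := .reg Reg.node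

/-- The word `a[r][i]` of the memory. -/
abbrev get (a : ℕ) (r i : Expr) : Expr := .read a r i

/-- `L := ⌈log σ⌉` -/
def levels : Cmd := block [
  .set Reg.L 0,
  .set Reg.pow 1,
  .while (.op .lt pow σ) (block [
    .set Reg.pow (pow * 2),
    .set Reg.L (L + 1)])]

/-- Fill the bitmap of level `l` from the sequence `a[r]`. -/
def fillBitmap (a : ℕ) (r : Expr) : Cmd :=
  .par Reg.i n (
    .ite (get a r i &&& mask)
      (.write Arr.B l i 1)
      (.write Arr.B l i 0))

/-- Prefix sum.  `N` := the least power of two that is at least `n`.  After the command `leaf` has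
set the leaves `T[l][N..2*N-1]` of a complete binary tree with root `1`, compute in every inner
node of `T[l]` the sum of the leaves below it, and in every node of `Q[l]` the sum of the leaves
to the left of its subtree.  So `T[l][1]` is the overall sum and `Q[l][N..2*N-1]` are the prefix
sums. -/
def prefixSum (leaf : Cmd) : Cmd := block [
  .set Reg.N 1,
  .while (.op .lt N n) (.set Reg.N (N * 2)),
  leaf,
  .set Reg.m (N / 2),
  .while m (block [
    .par Reg.i m (
      .write Arr.T l (m + i) (get Arr.T l (2 * (m + i)) + get Arr.T l (2 * (m + i) + 1))),
    .set Reg.m (m / 2)]),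
  .write Arr.Q l 1 0,
  .set Reg.m 1,
  .while (.op .lt m N) (block [
    .par Reg.i m (block [
      .write Arr.Q l (2 * (m + i)) (get Arr.Q l (m + i)),
      .write Arr.Q l (2 * (m + i) + 1) (get Arr.Q l (m + i) + get Arr.T l (2 * (m + i)))]),
    .set Reg.m (m * 2)])]

/-- Filter.  `O[l][0..cnt-1]` := the indices `i < n`, in increasing order, at which a node of level
`l` starts, i.e. `i = 0` or the top `l` bits of `S'[l][i]` and `S'[l][i-1]` differ; and
`O[l][cnt] := n`. -/
def nodeStarts : Cmd := block [
  prefixSum (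
    .par Reg.i n (
      .ite i
        (.ite (.op .eq (get Arr.S' l i >>> (L - l)) (get Arr.S' l (i - 1) >>> (L - l)))
          (.write Arr.T l (N + i) 0)
          (.write Arr.T l (N + i) 1))
        (.write Arr.T l (N + i) 1))),
  .par Reg.i n (
    .ite (get Arr.T l (N + i))
      (.write Arr.O l (get Arr.Q l (N + i)) i)
      .skip),
  .set Reg.cnt (get Arr.T l 1),
  .write Arr.O l cnt n]

/-- The algorithm sortWT, with the stable integer sort `P` as a subroutine.  All levels are
processed in parallel; the sequence is sorted by the top `l` bits of its symbols on level `l`. -/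
def sortWT (P : Cmd) : Cmd := block [
  levels,
  .par Reg.l L (block [
    .set Reg.mask ((1 : Expr) <<< (L - (l + 1))),
    .ite (.op .eq l 0)
      (block [
        fillBitmap Arr.S 0,
        .write Arr.Ptr 0 0 0,
        .write Arr.Len 0 0 n])
      (block [
        .par Reg.i n (.write Arr.K l i (get Arr.S 0 i >>> (L - l))),
        .call P n Arr.K l Arr.S 0 Arr.S' l,
        fillBitmap Arr.S' l,
        nodeStarts,
        .par Reg.i cnt (block [
          .set Reg.node ((1 : Expr) <<< l - 1 + (get Arr.S' l (get Arr.O l i) >>> (L - l))),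
          .write Arr.Ptr 0 node (get Arr.O l i),
          .write Arr.Len 0 node (get Arr.O l (i + 1) - get Arr.O l i)])])])]

end SortWT

/-- The initial state of sortWT: the length and the alphabet size in the registers `n` and `σ`,
the sequence in `S[0]`, and zeros elsewhere. -/
def wtInput (seq : List ℕ) (alphabet : ℕ) : State where
  reg := fun x => if x = Reg.n then seq.length else if x = Reg.σ then alphabet else 0
  mem := fun a r i => if a = Arr.S ∧ r = 0 then seq.getD i 0 else 0

/-- On the given sequence and random tape, sortWT with the sort `P` halts and stores the wavelet
tree; if the length is at least `n₀`, this takes at most `C * n * log log n * log σ` work and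
`C * log n` depth. -/
def BuildsWithin (w : ℕ) (ω : ℕ → Fin (2 ^ w)) (P : Cmd) (C : ℝ) (n₀ : ℕ) (seq : List ℕ)
    (alphabet : ℕ) : Prop :=
  ∃ fuel o, run w ω fuel (SortWT.sortWT P) (wtInput seq alphabet) = some o ∧
    StoresTree o.state.mem 0 0 (waveletTree (Nat.clog 2 alphabet) 0 seq) ∧
    (n₀ ≤ seq.length →
      (o.work : ℝ) ≤ C * (seq.length * Real.logb 2 (Real.logb 2 seq.length) *
        Real.logb 2 alphabet) ∧
      (o.depth : ℝ) ≤ C * Real.logb 2 seq.length)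

end WorkDepth

/-!
Correctness and costs of sortWT are proved in a small program logic. `Runs w ω c s Q W D` says that
the command `c` terminates from the state `s` in a state satisfying `Q`, with work at most `W` and
depth at most `D`. Since more fuel never changes the outcome of a terminating run (`run_mono`), the
triples compose: there are rules for sequences, branches, loops and calls, and for a parallel loop
it is enough to know, cell by cell, that all iterations which change the cell agree
(`mergeMem_eq`).

One level `l` of the tree is built as follows. Let `u i` be the top `l` bits of the `i`-th symbol
after the sort. Because the sort is stable, the symbols with top bits `p` form a segment of the
sorted sequence, and this segment is the subsequence of these symbols in the input
(`IsStableSort.segments`). So the bitmap of the node `p` is the segment `x p, …, x p + len p - 1` of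
the bitmap of the level. The flags at the positions where `u` changes are summed up in a binary tree
in `O(n)` work and `O(log n)` depth (`runs_prefixSum`): in the upward pass, a node of depth `d`
and number `p` gets the difference of the prefix sums at `(p + 1) * 2 ^ (t - d)` and at
`p * 2 ^ (t - d)`, and in the downward pass the latter prefix sum. Consequently the filter lists the
starts of the segments in order, the successor of `x p` in this list is `x p + len p`
(`runs_nodeStarts`, `Segments.startCount_end`), and the last loop stores `x p` and `len p` for
each node (`runs_levelSucc`).

Different levels write disjoint cells of the output arrays, so the parallel loop over the levels
stores all of them, and the recursive description of the wavelet tree follows by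
induction on the height of the node (`storesTree_of_storesLevel`). Each of the
`L = ⌈log σ⌉ ≤ 2 log σ` levels costs `O(n)` work and `O(log n)` depth on top of one call of the
sort, which gives the bounds (`buildsWithin_of_sortsWithin`), for each random tape on which the calls of
all levels succeed. As all levels read the same tape, no independence is available; the randomized
statement is a union bound over the `L` levels. The numerical constants in the cost bounds are
crude.
-/

namespace WorkDepth

/-! ### Fuel -/

theorem whileLoop_mono {test : State → ℕ} {k : ℕ} {body body' : State → Option Outcome}
    (h : ∀ s o, body s = some o → body' s = some o) :
    ∀ {f f' : ℕ}, f ≤ f' → ∀ {s o}, whileLoop test k body f s = some o →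
      whileLoop test k body' f' s = some o := by
  intro f
  induction f with
  | zero =>
    intro f' _ s o ho
    have ht : test s = 0 := by
      by_contra hne
      simp [whileLoop, hne] at ho
    cases f' <;> simpa [whileLoop, ht] using ho
  | succ f ih =>
    intro f' hf s o ho
    obtain ⟨g, rfl⟩ : ∃ g, f' = g + 1 := ⟨f' - 1, by omega⟩
    by_cases ht : test s = 0
    · simpa [whileLoop, ht] using ho
    · simp only [whileLoop, ht, if_false, Option.bind_eq_some_iff, Option.map_eq_some_iff] at ho ⊢
      obtain ⟨o₁, h₁, o₂, h₂, rfl⟩ := ho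
      exact ⟨o₁, h _ _ h₁, o₂, ih (by omega) h₂, rfl⟩

/-- A run that terminates has the same outcome with more fuel. -/
theorem run_mono {w : ℕ} {ω : ℕ → Fin (2 ^ w)} {f f' : ℕ} (hf : f ≤ f') (c : Cmd) :
    ∀ {s o}, run w ω f c s = some o → run w ω f' c s = some o := by
  induction c with
  | skip => exact fun h => h
  | set x e => exact fun h => h
  | write a r i e => exact fun h => h
  | seq c d ihc ihd =>
    intro s o h
    simp only [run, Option.bind_eq_some_iff, Option.map_eq_some_iff] at h ⊢
    obtain ⟨o₁, h₁, o₂, h₂, rfl⟩ := h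
    exact ⟨o₁, ihc h₁, o₂, ihd h₂, rfl⟩
  | ite e c d ihc ihd =>
    intro s o h
    simp only [run, Option.map_eq_some_iff] at h ⊢
    obtain ⟨o₁, h₁, rfl⟩ := h
    refine ⟨o₁, ?_, rfl⟩
    split_ifs at h₁ ⊢
    · exact ihc h₁
    · exact ihd h₁
  | par x e c ih =>
    intro s o h
    simp only [run] at h ⊢
    split_ifs at h with hs
    have key : ∀ j < e.eval w ω s,
        run w ω f' c (s.setReg x j) = run w ω f c (s.setReg x j) := by
      intro j hj
      obtain ⟨o₁, h₁⟩ := Option.isSome_iff_exists.1 (hs j hj)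
      rw [h₁, ih h₁]
    rw [if_pos fun j hj => by rw [key j hj]; exact hs j hj, ← h]
    have hm : ∀ (m m' : ℕ → Mem), (∀ j < e.eval w ω s, m j = m' j) →
        mergeMem (e.eval w ω s) s.mem m = mergeMem (e.eval w ω s) s.mem m' := by
      intro m m' hmm
      funext a r i
      have : (List.range (e.eval w ω s)).find? (fun j => m j a r i ≠ s.mem a r i) =
          (List.range (e.eval w ω s)).find? (fun j => m' j a r i ≠ s.mem a r i) := by
        apply List.find?_congr
        intro j hj
        rw [hmm j (List.mem_range.1 hj)]
      unfold mergeMem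
      rw [this]
      split
      · rename_i j hj
        rw [hmm j (List.mem_range.1 (List.mem_of_find?_eq_some hj))]
      · rfl
    congr 2
    · congr 1
      exact hm _ _ fun j hj => by rw [key j hj]
    · congr 1
      exact Finset.sum_congr rfl fun j hj => by rw [key j (Finset.mem_range.1 hj)]
    · congr 1
      exact Finset.sup_congr rfl fun j hj => by rw [key j (Finset.mem_range.1 hj)]
  | call p n ka kr va vr oa or ih =>
    intro s o h
    simp only [run, Option.map_eq_some_iff] at h ⊢
    obtain ⟨o₁, h₁, rfl⟩ := h
    exact ⟨o₁, ih h₁, rfl⟩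
  | _ e c ih =>
    -- the only case left is that of a while loop
    intro s o h
    exact whileLoop_mono (fun s o => ih) hf h

/-! ### A program logic with costs -/

/-- The command `c` terminates from the state `s`, in a state that satisfies `Q`, with at most
`W` operations and at most `D` time steps. -/
def Runs (w : ℕ) (ω : ℕ → Fin (2 ^ w)) (c : Cmd) (s : State) (Q : State → Prop) (W D : ℕ) : Prop :=
  ∃ fuel o, run w ω fuel c s = some o ∧ Q o.state ∧ o.work ≤ W ∧ o.depth ≤ D

variable {w : ℕ} {ω : ℕ → Fin (2 ^ w)} {s : State} {Q R : State → Prop} {W D W' D' : ℕ}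
  {c d : Cmd}

theorem Runs.mono (h : Runs w ω c s Q W D) (hQ : ∀ s', Q s' → R s') (hW : W ≤ W')
    (hD : D ≤ D') : Runs w ω c s R W' D' := by
  obtain ⟨f, o, h₁, h₂, h₃, h₄⟩ := h
  exact ⟨f, o, h₁, hQ _ h₂, h₃.trans hW, h₄.trans hD⟩

theorem Runs.skip (h : Q s) : Runs w ω .skip s Q 1 1 := ⟨0, _, rfl, h, le_rfl, le_rfl⟩

theorem Runs.set {x : ℕ} {e : Expr} {v : ℕ} (he : e.eval w ω s = v) (h : Q (s.setReg x v)) :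
    Runs w ω (.set x e) s Q (1 + e.size) (1 + e.size) := by
  subst he
  exact ⟨0, _, rfl, h, le_rfl, le_rfl⟩

theorem Runs.write {a : ℕ} {r i e : Expr} {ρ ι v : ℕ} (hr : r.eval w ω s = ρ)
    (hi : i.eval w ω s = ι) (he : e.eval w ω s = v) (h : Q (s.setMem a ρ ι v)) :
    Runs w ω (.write a r i e) s Q (1 + r.size + i.size + e.size)
      (1 + r.size + i.size + e.size) := by
  subst hr hi he
  exact ⟨0, _, rfl, h, le_rfl, le_rfl⟩

theorem Runs.seq (h : Runs w ω c s R W D) (h' : ∀ s', R s' → Runs w ω d s' Q W' D') :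
    Runs w ω (.seq c d) s Q (W + W') (D + D') := by
  obtain ⟨f, o, h₁, h₂, h₃, h₄⟩ := h
  obtain ⟨f', o', h₁', h₂', h₃', h₄'⟩ := h' _ h₂
  refine ⟨max f f', ⟨o'.state, o.work + o'.work, o.depth + o'.depth⟩, ?_, h₂',
    Nat.add_le_add h₃ h₃', Nat.add_le_add h₄ h₄'⟩
  simp only [run, Option.bind_eq_some_iff, Option.map_eq_some_iff]
  exact ⟨o, run_mono (le_max_left _ _) _ h₁, o', run_mono (le_max_right _ _) _ h₁', rfl⟩

theorem Runs.ite {e : Expr} {v : ℕ} (he : e.eval w ω s = v)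
    (h₁ : v ≠ 0 → Runs w ω c s Q W D) (h₀ : v = 0 → Runs w ω d s Q W D) :
    Runs w ω (.ite e c d) s Q (1 + e.size + W) (1 + e.size + D) := by
  subst he
  by_cases hv : e.eval w ω s = 0
  · obtain ⟨f, o, h₁, h₂, h₃, h₄⟩ := h₀ hv
    exact ⟨f, o.charge (1 + e.size), by simp [run, hv, h₁], h₂, by simpa [Outcome.charge],
      by simpa [Outcome.charge]⟩
  · obtain ⟨f, o, h₁, h₂, h₃, h₄⟩ := h₁ hv
    exact ⟨f, o.charge (1 + e.size), by simp [run, hv, h₁], h₂, by simpa [Outcome.charge],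
      by simpa [Outcome.charge]⟩

/-- The rule for a loop with `t` iterations; `I i` is the invariant after `i` iterations, and
`V i` bounds the work of the iteration that follows. -/
theorem Runs.while {e : Expr} (t : ℕ) (I : ℕ → State → Prop) (V : ℕ → ℕ) (h₀ : I 0 s)
    (hstep : ∀ i < t, ∀ s, I i s → e.eval w ω s ≠ 0 ∧ Runs w ω c s (I (i + 1)) (V i) D)
    (hend : ∀ s, I t s → e.eval w ω s = 0 ∧ Q s) :
    Runs w ω (.while e c) s Q (1 + e.size + ∑ i ∈ Finset.range t, (1 + e.size + V i))
      (1 + e.size + t * (1 + e.size + D)) := by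
  induction t generalizing s I V with
  | zero =>
    obtain ⟨h, hQ⟩ := hend _ h₀
    exact ⟨0, ⟨s, 1 + e.size, 1 + e.size⟩, by simp [run, whileLoop, h], hQ, by simp, by simp⟩
  | succ t ih =>
    obtain ⟨hne, f, o, h₁, h₂, h₃, h₄⟩ := hstep 0 (by omega) s h₀
    obtain ⟨f', o', h₁', h₂', h₃', h₄'⟩ := ih (fun i => I (i + 1)) (fun i => V (i + 1)) h₂
      (fun i hi => hstep (i + 1) (by omega)) hend
    refine ⟨max f f' + 1, ⟨o'.state, 1 + e.size + o.work + o'.work,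
      1 + e.size + o.depth + o'.depth⟩, ?_, h₂', ?_, ?_⟩
    · simp only [run, whileLoop, hne, if_false, Option.bind_eq_some_iff, Option.map_eq_some_iff]
      refine ⟨o, run_mono (by omega) _ h₁, o', ?_, rfl⟩
      exact whileLoop_mono (fun s o => run_mono (by omega) c) (le_max_right f f') h₁'
    · rw [Finset.sum_range_succ']
      simp only at h₃' ⊢
      omega
    · simp only at h₄' ⊢
      rw [Nat.add_mul]
      omega

/-- A cell that every parallel iteration leaves alone or sets to `v` has the value `v` at the
join, provided that some iteration sets it or it had this value before. -/
theorem mergeMem_eq {k : ℕ} {m₀ : Mem} {m : ℕ → Mem} {a r i v : ℕ}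
    (h : ∀ j < k, m j a r i = m₀ a r i ∨ m j a r i = v)
    (h' : m₀ a r i = v ∨ ∃ j < k, m j a r i = v) : mergeMem k m₀ m a r i = v := by
  unfold mergeMem
  split
  · rename_i j hj
    have h₁ := List.find?_some hj
    have h₂ := List.mem_range.1 (List.mem_of_find?_eq_some hj)
    exact (h j h₂).resolve_left (by simpa using h₁)
  · rename_i hn
    rw [List.find?_eq_none] at hn
    rcases h' with h' | ⟨j, hj, hv⟩
    · exact h'
    · have := hn j (List.mem_range.2 hj)
      rw [← hv]
      simpa using (Eq.symm (by simpa using this))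

theorem mergeMem_eq_self {k : ℕ} {m₀ : Mem} {m : ℕ → Mem} {a r i : ℕ}
    (h : ∀ j < k, m j a r i = m₀ a r i) : mergeMem k m₀ m a r i = m₀ a r i :=
  mergeMem_eq (fun j hj => .inl (h j hj)) (.inl rfl)

theorem Runs.par {x : ℕ} {e : Expr} {k : ℕ} (he : e.eval w ω s = k) (R : ℕ → Mem → Prop)
    (h : ∀ j < k, Runs w ω c (s.setReg x j) (fun s' => R j s'.mem) W D)
    (hQ : ∀ m : ℕ → Mem, (∀ j < k, R j (m j)) → Q ⟨s.reg, mergeMem k s.mem m⟩) :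
    Runs w ω (.par x e c) s Q (1 + e.size + k * (1 + W)) (1 + e.size + (1 + D)) := by
  subst he
  have : Inhabited Outcome := ⟨⟨s, 0, 0⟩⟩
  choose! f o h₁ h₂ h₃ h₄ using h
  set k := e.eval w ω s with hk
  set F := (Finset.range k).sup f
  have hF : ∀ j < k, run w ω F c (s.setReg x j) = some (o j) := fun j hj =>
    run_mono (Finset.le_sup (f := f) (Finset.mem_range.2 hj)) _ (h₁ j hj)
  let o' : ℕ → Outcome := fun j => (run w ω F c (s.setReg x j)).getD ⟨s, 0, 0⟩
  refine ⟨F, ⟨⟨s.reg, mergeMem k s.mem fun j => (o' j).state.mem⟩,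
    1 + e.size + ∑ j ∈ Finset.range k, (1 + (o' j).work),
    1 + e.size + (Finset.range k).sup fun j => 1 + (o' j).depth⟩, ?_, hQ _ ?_, ?_, ?_⟩
  · simp only [run]
    rw [if_pos fun j hj => by rw [hF j hj]; rfl]
  · intro j hj
    simp only [o', hF j hj]
    exact h₂ j hj
  · refine Nat.add_le_add_left ?_ _
    refine (Finset.sum_le_card_nsmul _ _ (1 + W) fun j hj => ?_).trans (by simp)
    simp only [o', hF j (Finset.mem_range.1 hj)]
    exact Nat.add_le_add_left (h₃ j (Finset.mem_range.1 hj)) _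
  · refine Nat.add_le_add_left (Finset.sup_le fun j hj => ?_) _
    simp only [o', hF j (Finset.mem_range.1 hj)]
    exact Nat.add_le_add_left (h₄ j (Finset.mem_range.1 hj)) _

/-- The memory `m` with the row `a[r]` replaced by `g`. -/
def setRow (m : Mem) (a r : ℕ) (g : ℕ → ℕ) : Mem := fun a' r' i =>
  if a' = a ∧ r' = r then g i else m a' r' i

theorem setRow_same (m : Mem) (a r : ℕ) (g : ℕ → ℕ) (i : ℕ) : setRow m a r g a r i = g i := by
  simp [setRow]

theorem setRow_of_ne (m : Mem) {a r a' r' : ℕ} (g : ℕ → ℕ) (i : ℕ) (h : ¬ (a' = a ∧ r' = r)) :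
    setRow m a r g a' r' i = m a' r' i := by
  simp [setRow, h]

theorem setMem_same (s : State) (a r i v : ℕ) : (s.setMem a r i v).mem a r i = v := by
  simp [State.setMem]

theorem setMem_of_ne (s : State) {a r i a' r' i' : ℕ} (v : ℕ)
    (h : ¬ (a' = a ∧ r' = r ∧ i' = i)) : (s.setMem a r i v).mem a' r' i' = s.mem a' r' i' := by
  simp [State.setMem, h]

/-- A parallel loop in which each iteration writes one cell of the row `a[r]`. -/
theorem Runs.par_row {x : ℕ} {e : Expr} {k a r : ℕ} (idx v g : ℕ → ℕ) (he : e.eval w ω s = k)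
    (h : ∀ j < k, Runs w ω c (s.setReg x j)
      (fun s' => s'.mem = (s.setMem a r (idx j) (v j)).mem) W D)
    (hg : ∀ j < k, g (idx j) = v j) (hg' : ∀ i, (∀ j < k, idx j ≠ i) → g i = s.mem a r i)
    (hQ : Q ⟨s.reg, setRow s.mem a r g⟩) :
    Runs w ω (.par x e c) s Q (1 + e.size + k * (1 + W)) (1 + e.size + (1 + D)) := by
  refine Runs.par he (fun j m => m = (s.setMem a r (idx j) (v j)).mem) h fun m hm => ?_
  convert hQ using 2
  funext a' r' i
  by_cases har : a' = a ∧ r' = r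
  · obtain ⟨rfl, rfl⟩ := har
    rw [setRow_same]
    apply mergeMem_eq
    · intro j hj
      rw [hm j hj]
      by_cases hi : i = idx j
      · subst hi
        rw [setMem_same, hg j hj]
        exact .inr rfl
      · exact .inl (setMem_of_ne _ _ (by tauto))
    · by_cases hi : ∃ j < k, idx j = i
      · obtain ⟨j, hj, rfl⟩ := hi
        exact .inr ⟨j, hj, by rw [hm j hj, setMem_same, hg j hj]⟩
      · push Not at hi
        exact .inl (hg' i hi).symm
  · rw [setRow_of_ne _ _ _ har]
    apply mergeMem_eq_self
    intro j hj
    rw [hm j hj]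
    exact setMem_of_ne _ _ (by tauto)

/-- A subroutine call; the input of the subroutine only matters on the first `n` records. -/
theorem Runs.call {P : Cmd} {ne kr vr or : Expr} {ka va oa n ρ : ℕ} {key val : ℕ → ℕ}
    (hn : ne.eval w ω s = n) (hkey : ∀ i < n, s.mem ka (kr.eval w ω s) i = key i)
    (hval : ∀ i < n, s.mem va (vr.eval w ω s) i = val i) (hor : or.eval w ω s = ρ)
    (hP : Runs w ω P (sortInput n key val) R W D)
    (hQ : ∀ s', R s' → Q ⟨s.reg, setRow s.mem oa ρ
      fun i => if i < n then s'.mem 2 0 i else s.mem oa ρ i⟩) :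
    Runs w ω (.call P ne ka kr va vr oa or) s Q
      (1 + ne.size + kr.size + vr.size + or.size + 3 * n + W)
      (1 + ne.size + kr.size + vr.size + or.size + 1 + D) := by
  obtain ⟨f, o, h₁, h₂, h₃, h₄⟩ := hP
  have hin : sortInput n (s.mem ka (kr.eval w ω s)) (s.mem va (vr.eval w ω s)) =
      sortInput n key val := by
    unfold sortInput
    congr 1
    funext a r i
    by_cases hi : i < n
    · rw [hkey i hi, hval i hi]
    · simp [hi]
  subst hn hor
  refine ⟨f, ⟨_, 1 + ne.size + kr.size + vr.size + or.size + 3 * ne.eval w ω s + o.work,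
    1 + ne.size + kr.size + vr.size + or.size + 1 + o.depth⟩, ?_, hQ _ h₂, ?_, ?_⟩
  · simp only [run, hin, h₁]
    simp only [Option.map_some, Option.some.injEq]
    refine congrArg (fun m => (⟨⟨s.reg, m⟩, _, _⟩ : Outcome)) ?_
    funext a r i
    unfold setRow
    by_cases ha : a = oa ∧ r = or.eval w ω s
    · obtain ⟨rfl, rfl⟩ := ha
      simp
    · have : ¬ (a = oa ∧ r = or.eval w ω s ∧ i < ne.eval w ω s) := by tauto
      simp [ha, this]
  · exact Nat.add_le_add_left h₃ _
  · exact Nat.add_le_add_left h₄ _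

/-! ### Evaluation of expressions without overflow -/

section Eval

variable {e f : Expr} {a b : ℕ}

theorem eval_zero : (0 : Expr).eval w ω s = 0 := Nat.zero_mod _

theorem eval_one (h : 2 < 2 ^ w) : (1 : Expr).eval w ω s = 1 :=
  Nat.mod_eq_of_lt (lt_trans one_lt_two h)

theorem eval_two (h : 2 < 2 ^ w) : (2 : Expr).eval w ω s = 2 := Nat.mod_eq_of_lt h

theorem eval_reg {x : ℕ} (h : s.reg x = a) : (Expr.reg x).eval w ω s = a := h

theorem eval_add (he : e.eval w ω s = a) (hf : f.eval w ω s = b) (h : a + b < 2 ^ w) :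
    (e + f).eval w ω s = a + b := by
  subst he hf; exact Nat.mod_eq_of_lt h

theorem eval_sub (he : e.eval w ω s = a) (hf : f.eval w ω s = b) (h : a - b < 2 ^ w) :
    (e - f).eval w ω s = a - b := by
  subst he hf; exact Nat.mod_eq_of_lt h

theorem eval_mul (he : e.eval w ω s = a) (hf : f.eval w ω s = b) (h : a * b < 2 ^ w) :
    (e * f).eval w ω s = a * b := by
  subst he hf; exact Nat.mod_eq_of_lt h

theorem eval_div (he : e.eval w ω s = a) (hf : f.eval w ω s = b) (h : a < 2 ^ w) :
    (e / f).eval w ω s = a / b := by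
  subst he hf; exact Nat.mod_eq_of_lt ((Nat.div_le_self _ _).trans_lt h)

theorem eval_one_shiftLeft (hf : f.eval w ω s = b) (h : 2 ^ b < 2 ^ w) :
    ((1 : Expr) <<< f).eval w ω s = 2 ^ b := by
  have h1 : (1 : Expr).eval w ω s = 1 :=
    Nat.mod_eq_of_lt ((Nat.one_le_two_pow).trans_lt h)
  subst hf
  have : (((1 : Expr) <<< f).eval w ω s) =
    ((1 : Expr).eval w ω s <<< f.eval w ω s) % 2 ^ w := rfl
  rw [this, h1, Nat.one_shiftLeft, Nat.mod_eq_of_lt h]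

theorem eval_shiftRight (he : e.eval w ω s = a) (hf : f.eval w ω s = b) (h : a < 2 ^ w) :
    (e >>> f).eval w ω s = a / 2 ^ b := by
  subst he hf
  have : ((e >>> f).eval w ω s) = (e.eval w ω s >>> f.eval w ω s) % 2 ^ w := rfl
  rw [this, Nat.shiftRight_eq_div_pow]
  exact Nat.mod_eq_of_lt ((Nat.div_le_self _ _).trans_lt h)

theorem eval_and (he : e.eval w ω s = a) (hf : f.eval w ω s = b) (h : b < 2 ^ w) :
    (e &&& f).eval w ω s = a &&& b := by
  subst he hf; exact Nat.mod_eq_of_lt (Nat.and_le_right.trans_lt h)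

theorem eval_lt (he : e.eval w ω s = a) (hf : f.eval w ω s = b) (h : 1 < 2 ^ w) :
    (Expr.op .lt e f).eval w ω s = if a < b then 1 else 0 := by
  subst he hf
  refine Nat.mod_eq_of_lt ?_
  simp only [Op.eval]
  split_ifs <;> omega

theorem eval_eq (he : e.eval w ω s = a) (hf : f.eval w ω s = b) (h : 1 < 2 ^ w) :
    (Expr.op .eq e f).eval w ω s = if a = b then 1 else 0 := by
  subst he hf
  refine Nat.mod_eq_of_lt ?_
  simp only [Op.eval]
  split_ifs <;> omega

theorem eval_read {k : ℕ} (he : e.eval w ω s = a) (hf : f.eval w ω s = b) :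
    (Expr.read k e f).eval w ω s = s.mem k a b := by
  subst he hf; rfl

end Eval

theorem setReg_same (s : State) (x v : ℕ) : (s.setReg x v).reg x = v := by simp [State.setReg]

theorem setReg_of_ne (s : State) {x y : ℕ} (v : ℕ) (h : y ≠ x) :
    (s.setReg x v).reg y = s.reg y := by simp [State.setReg, h]

theorem Runs.set_seq {x : ℕ} {e : Expr} {v : ℕ} (he : e.eval w ω s = v)
    (h : Runs w ω d (s.setReg x v) Q W D) :
    Runs w ω (.seq (.set x e) d) s Q (1 + e.size + W) (1 + e.size + D) :=
  Runs.seq (R := (· = s.setReg x v)) (Runs.set he rfl) fun _ h' => h' ▸ h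

theorem Runs.write_seq {a : ℕ} {r i e : Expr} {ρ ι v : ℕ} (hr : r.eval w ω s = ρ)
    (hi : i.eval w ω s = ι) (he : e.eval w ω s = v)
    (h : Runs w ω d (s.setMem a ρ ι v) Q W D) :
    Runs w ω (.seq (.write a r i e) d) s Q (1 + r.size + i.size + e.size + W)
      (1 + r.size + i.size + e.size + D) :=
  Runs.seq (R := (· = s.setMem a ρ ι v)) (Runs.write hr hi he rfl) fun _ h' => h' ▸ h

theorem size_zero : (0 : Expr).size = 1 := rfl
theorem size_one : (1 : Expr).size = 1 := rfl
theorem size_two : (2 : Expr).size = 1 := rfl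
theorem size_reg (x : ℕ) : (Expr.reg x).size = 1 := rfl
theorem size_op (o : Op) (e f : Expr) : (Expr.op o e f).size = e.size + f.size + 1 := rfl
theorem size_read (a : ℕ) (e f : Expr) : (Expr.read a e f).size = e.size + f.size + 1 := rfl
theorem size_add (e f : Expr) : (e + f).size = e.size + f.size + 1 := rfl
theorem size_sub (e f : Expr) : (e - f).size = e.size + f.size + 1 := rfl
theorem size_mul (e f : Expr) : (e * f).size = e.size + f.size + 1 := rfl
theorem size_div (e f : Expr) : (e / f).size = e.size + f.size + 1 := rfl
theorem size_shl (e f : Expr) : (e <<< f).size = e.size + f.size + 1 := rfl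
theorem size_shr (e f : Expr) : (e >>> f).size = e.size + f.size + 1 := rfl
theorem size_and (e f : Expr) : (e &&& f).size = e.size + f.size + 1 := rfl

theorem setRow_setRow (m : Mem) (a r : ℕ) (g h : ℕ → ℕ) :
    setRow (setRow m a r g) a r h = setRow m a r h := by
  funext a' r' i
  simp only [setRow]
  split_ifs <;> rfl

theorem setMem_mem (s : State) (a r i v : ℕ) :
    (s.setMem a r i v).mem = setRow s.mem a r (Function.update (s.mem a r) i v) := by
  funext a' r' i'
  simp only [setRow, State.setMem, Function.update_apply]
  split_ifs <;> simp_all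

/-! ### The simple loops of the algorithm -/

open SortWT

theorem two_pow_clog_lt {n : ℕ} (hn : 2 ≤ n) : 2 ^ Nat.clog 2 n < 2 * n := by
  have h := Nat.pow_pred_clog_lt_self (b := 2) (by norm_num) (x := n) (by omega)
  have h0 := Nat.clog_pos (b := 2) (by norm_num) hn
  obtain ⟨k, hk⟩ : ∃ k, Nat.clog 2 n = k + 1 := ⟨Nat.clog 2 n - 1, by omega⟩
  rw [hk] at h ⊢
  rw [pow_succ]
  simp only [Nat.pred_eq_sub_one, Nat.add_sub_cancel] at h
  omega

theorem clog_le_self (n : ℕ) : Nat.clog 2 n ≤ n :=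
  Nat.clog_le_of_le_pow Nat.lt_two_pow_self.le

theorem runs_levels {σ : ℕ} (hσ : s.reg Reg.σ = σ) (h2 : 2 ≤ σ) (hw : 2 * σ ≤ 2 ^ w) :
    Runs w ω levels s (fun s' => s'.mem = s.mem ∧ s'.reg Reg.L = Nat.clog 2 σ ∧
        ∀ x, x ≠ Reg.L → x ≠ Reg.pow → s'.reg x = s.reg x)
      (12 * (Nat.clog 2 σ + 1)) (12 * (Nat.clog 2 σ + 1)) := by
  have hpow := two_pow_clog_lt h2
  have hle := clog_le_self σ
  have hw2 : 2 < 2 ^ w := by omega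
  refine Runs.mono (Runs.set_seq eval_zero <|
    Runs.set_seq (eval_one hw2) <|
    Runs.while (D := 8) (Nat.clog 2 σ) (fun i s' => s'.mem = s.mem ∧ s'.reg Reg.L = i ∧
      s'.reg Reg.pow = 2 ^ i ∧ ∀ x, x ≠ Reg.L → x ≠ Reg.pow → s'.reg x = s.reg x)
      (fun _ => 8) ?_ ?_ ?_) (fun _ h => h) ?_ ?_
  · refine ⟨rfl, ?_, setReg_same _ _ _, fun x h h' => ?_⟩
    · rw [setReg_of_ne _ _ (by decide), setReg_same]
    · rw [setReg_of_ne _ _ h', setReg_of_ne _ _ h]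
  · rintro i hi s' ⟨hm, hL, hp, hx⟩
    have hi' : 2 ^ i < σ := (Nat.lt_clog_iff_pow_lt (by norm_num)).1 hi
    have hσ' : s'.reg Reg.σ = σ := by rw [hx _ (by decide) (by decide), hσ]
    have ht : (Expr.op .lt pow SortWT.σ).eval w ω s' = 1 := by
      rw [eval_lt (eval_reg hp) (eval_reg hσ') (by omega), if_pos hi']
    refine ⟨by rw [ht]; simp, ?_⟩
    refine Runs.mono (Runs.set_seq (eval_mul (eval_reg hp) (eval_two hw2) (by omega)) <|
      Runs.set (eval_add (a := i) (eval_reg ?_) (eval_one hw2) ?_) ?_)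
      (fun _ h => h) ?_ ?_
    · exact (setReg_of_ne _ _ (by decide)).trans hL
    · omega
    · refine ⟨hm, setReg_same _ _ _, ?_, fun x h h' => ?_⟩
      · rw [setReg_of_ne _ _ (by decide), setReg_same, pow_succ]
      · rw [setReg_of_ne _ _ h, setReg_of_ne _ _ h', hx _ h h']
    all_goals simp only [size_one, size_two, size_reg, size_add, size_mul]; norm_num
  · rintro s' ⟨hm, hL, hp, hx⟩
    have hσ' : s'.reg Reg.σ = σ := by rw [hx _ (by decide) (by decide), hσ]
    refine ⟨?_, hm, hL, hx⟩
    rw [eval_lt (eval_reg hp) (eval_reg hσ') (by omega), if_neg]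
    exact not_lt.2 (Nat.le_pow_clog (by norm_num) _)
  all_goals
    simp only [size_zero, size_one, size_reg, size_op, Finset.sum_const, Finset.card_range, smul_eq_mul]
    omega

theorem runs_fillBitmap {a n l k ρ : ℕ} {r : Expr} (hn : s.reg Reg.n = n) (hl : s.reg Reg.l = l)
    (hmask : s.reg Reg.mask = 2 ^ k) (hw : 2 ^ k < 2 ^ w)
    (hw2 : 2 < 2 ^ w)     (hr : ∀ j, r.eval w ω (s.setReg Reg.i j) = ρ) (hsize : r.size = 1) :
    Runs w ω (fillBitmap a r) s (fun s' => s' = ⟨s.reg, setRow s.mem Arr.B l fun i =>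
        if i < n then (if s.mem a ρ i &&& 2 ^ k ≠ 0 then 1 else 0) else s.mem Arr.B l i⟩)
      (12 * (n + 1)) 14 := by
  have hne (j x : ℕ) (h : x ≠ Reg.i) : (s.setReg Reg.i j).reg x = s.reg x := setReg_of_ne _ _ h
  refine Runs.mono (Runs.par_row (W := 10) (D := 10) (k := n) (a := Arr.B) (r := l) id
    (fun i => if s.mem a ρ i &&& 2 ^ k ≠ 0 then 1 else 0)
    (fun i => if i < n then (if s.mem a ρ i &&& 2 ^ k ≠ 0 then 1 else 0) else s.mem Arr.B l i)
    hn (fun j hj => ?_) (fun j hj => if_pos hj) (fun i hi => if_neg fun hin => hi i hin rfl) rfl)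
    (fun _ h => h.symm) ?_ ?_
  · have hmask' : (s.setReg Reg.i j).reg Reg.mask = 2 ^ k := (hne j _ (by decide)).trans hmask
    have hl' : (s.setReg Reg.i j).reg Reg.l = l := (hne j _ (by decide)).trans hl
    refine Runs.mono (Runs.ite (W := 4) (D := 4) (eval_and
      (eval_read (hr j) (eval_reg (setReg_same _ _ _)))
      (eval_reg hmask') hw) (fun h => ?_) (fun h => ?_)) (fun _ h => h)
      ?_ ?_
    · refine Runs.mono (Runs.write (eval_reg hl') (eval_reg (setReg_same _ _ _)) (eval_one hw2) ?_)
        (fun _ h => h) ?_ ?_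
      · have h : s.mem a ρ j &&& 2 ^ k ≠ 0 := h
        simp only [h, if_true, id, ne_eq, not_false_iff]
        rfl
      all_goals simp only [size_one, size_reg]; norm_num
    · refine Runs.mono (Runs.write (eval_reg hl') (eval_reg (setReg_same _ _ _)) eval_zero ?_)
        (fun _ h => h) ?_ ?_
      · have h : s.mem a ρ j &&& 2 ^ k = 0 := h
        simp only [h, if_false, id, ne_eq, not_true]
        rfl
      all_goals simp only [size_zero, size_reg]; norm_num
    all_goals simp only [size_read, size_reg, size_and, hsize]; norm_num
  all_goals simp only [size_reg]; omega

/-! ### The prefix sum -/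

theorem sum_two_pow_lt (t : ℕ) : ∑ i ∈ Finset.range t, 2 ^ i < 2 ^ t := by
  induction t with
  | zero => simp
  | succ t ih => rw [Finset.sum_range_succ, pow_succ]; omega

/-- `P` is the sequence of prefix sums of the leaves of a complete binary tree of height `t`, and
the nodes of depth at least `δ` of the tree, stored in `g`, hold the sums of the leaves below
them.  The node number `p` of depth `d` has the index `2 ^ d + p`. -/
def SumsBelow (P g : ℕ → ℕ) (t δ : ℕ) : Prop :=
  ∀ d p, δ ≤ d → d ≤ t → p < 2 ^ d →
    g (2 ^ d + p) + P (p * 2 ^ (t - d)) = P ((p + 1) * 2 ^ (t - d))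

theorem SumsBelow.pred {P g g' : ℕ → ℕ} {t δ : ℕ} (h : SumsBelow P g t (δ + 1)) (hδ : δ < t)
    (hg : ∀ p < 2 ^ δ, g' (2 ^ δ + p) = g (2 * (2 ^ δ + p)) + g (2 * (2 ^ δ + p) + 1))
    (hg' : ∀ v, 2 ^ (δ + 1) ≤ v → g' v = g v) : SumsBelow P g' t δ := by
  intro d p hd hdt hp
  rcases Nat.eq_or_lt_of_le hd with rfl | hd
  · have h1 := h (δ + 1) (2 * p) le_rfl (by omega) (by rw [pow_succ]; omega)
    have h2 := h (δ + 1) (2 * p + 1) le_rfl (by omega) (by rw [pow_succ]; omega)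
    have e0 : t - δ = (t - (δ + 1)) + 1 := by omega
    rw [hg p hp, e0, pow_succ]
    have e1 : 2 ^ (δ + 1) + 2 * p = 2 * (2 ^ δ + p) := by ring
    have e2 : 2 ^ (δ + 1) + (2 * p + 1) = 2 * (2 ^ δ + p) + 1 := by ring
    have e3 : p * (2 ^ (t - (δ + 1)) * 2) = 2 * p * 2 ^ (t - (δ + 1)) := by ring
    have e4 : (p + 1) * (2 ^ (t - (δ + 1)) * 2) = (2 * p + 1 + 1) * 2 ^ (t - (δ + 1)) := by ring
    rw [e1] at h1
    rw [e2] at h2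
    rw [e3, e4]
    omega
  · have : 2 ^ (δ + 1) ≤ 2 ^ d := Nat.pow_le_pow_right (by norm_num) hd
    rw [hg' _ (by omega)]
    exact h d p hd hdt hp

/-- A level of the upward pass: every node of depth `δ` receives the sum of its children. -/
theorem runs_upLevel {l δ : ℕ} (hl : s.reg Reg.l = l) (hm : s.reg Reg.m = 2 ^ δ)
    (hw : 4 * 2 ^ δ ≤ 2 ^ w)
    (hsum : ∀ p < 2 ^ δ, s.mem Arr.T l (2 * (2 ^ δ + p)) + s.mem Arr.T l (2 * (2 ^ δ + p) + 1) <
      2 ^ w) :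
    Runs w ω (.par Reg.i m (.write Arr.T SortWT.l (m + i)
        (SortWT.get Arr.T SortWT.l (2 * (m + i)) + SortWT.get Arr.T SortWT.l (2 * (m + i) + 1)))) s
      (fun s' => s'.reg = s.reg ∧ ∃ g, s'.mem = setRow s.mem Arr.T l g ∧
        (∀ p < 2 ^ δ, g (2 ^ δ + p) =
          s.mem Arr.T l (2 * (2 ^ δ + p)) + s.mem Arr.T l (2 * (2 ^ δ + p) + 1)) ∧
        ∀ v, 2 ^ (δ + 1) ≤ v → g v = s.mem Arr.T l v) (2 + 24 * 2 ^ δ) 26 := by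
  have h1 : 1 ≤ 2 ^ δ := Nat.one_le_two_pow
  have hw2 : 2 < 2 ^ w := by omega
  set v : ℕ → ℕ := fun j => s.mem Arr.T l (2 * (2 ^ δ + j)) + s.mem Arr.T l (2 * (2 ^ δ + j) + 1)
  refine Runs.mono (Runs.par_row (W := 23) (D := 23) (a := Arr.T) (r := l) (fun j => 2 ^ δ + j) v
    (fun i => if 2 ^ δ ≤ i ∧ i < 2 ^ (δ + 1) then v (i - 2 ^ δ) else s.mem Arr.T l i)
    (eval_reg hm) (fun j hj => ?_) (fun j hj => ?_) (fun i hi => ?_)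
    (Q := fun s' => s' = ⟨s.reg, setRow s.mem Arr.T l _⟩) rfl) ?_ ?_ ?_
  · have hl' : (s.setReg Reg.i j).reg Reg.l = l := (setReg_of_ne _ _ (by decide)).trans hl
    have hm' : (s.setReg Reg.i j).reg Reg.m = 2 ^ δ := (setReg_of_ne _ _ (by decide)).trans hm
    have hmi : (m + i).eval w ω (s.setReg Reg.i j) = 2 ^ δ + j :=
      eval_add (eval_reg hm') (eval_reg (setReg_same _ _ _)) (by omega)
    have h2mi := eval_mul (eval_two hw2) hmi (by omega)
    refine Runs.mono (Runs.write (eval_reg hl') hmi (eval_add (eval_read (eval_reg hl') h2mi)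
      (eval_read (eval_reg hl') (eval_add h2mi (eval_one hw2) (by omega))) (hsum j hj)) rfl)
      (fun _ h => h ▸ rfl) ?_ ?_
    all_goals simp only [size_one, size_two, size_reg, size_add, size_mul, size_read]; norm_num
  · rw [if_pos (by rw [pow_succ]; omega), Nat.add_sub_cancel_left]
  · refine if_neg fun h => hi (i - 2 ^ δ) ?_ ?_ <;> rw [pow_succ] at h <;> omega
  · rintro s' rfl
    refine ⟨rfl, _, rfl, fun p hp => ?_, fun v hv => if_neg (by omega)⟩
    rw [if_pos (by rw [pow_succ]; omega), Nat.add_sub_cancel_left]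
  all_goals simp only [size_reg]; omega

/-- A level of the downward pass: the children of every node of depth `δ` receive the prefix sums
at their first leaves. -/
theorem runs_downLevel {l δ : ℕ} (hl : s.reg Reg.l = l) (hm : s.reg Reg.m = 2 ^ δ)
    (hw : 4 * 2 ^ δ ≤ 2 ^ w)
    (hsum : ∀ p < 2 ^ δ, s.mem Arr.Q l (2 ^ δ + p) + s.mem Arr.T l (2 * (2 ^ δ + p)) < 2 ^ w) :
    Runs w ω (.par Reg.i m (block [
        .write Arr.Q SortWT.l (2 * (m + i)) (SortWT.get Arr.Q SortWT.l (m + i)),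
        .write Arr.Q SortWT.l (2 * (m + i) + 1) (SortWT.get Arr.Q SortWT.l (m + i) +
          SortWT.get Arr.T SortWT.l (2 * (m + i)))])) s
      (fun s' => s'.reg = s.reg ∧ ∃ g, s'.mem = setRow s.mem Arr.Q l g ∧
        (∀ p < 2 ^ δ, g (2 * (2 ^ δ + p)) = s.mem Arr.Q l (2 ^ δ + p) ∧
          g (2 * (2 ^ δ + p) + 1) =
            s.mem Arr.Q l (2 ^ δ + p) + s.mem Arr.T l (2 * (2 ^ δ + p))) ∧
        ∀ v < 2 ^ (δ + 1), g v = s.mem Arr.Q l v) (2 + 36 * 2 ^ δ) 38 := by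
  have h1 : 1 ≤ 2 ^ δ := Nat.one_le_two_pow
  have hw2 : 2 < 2 ^ w := by omega
  refine Runs.mono (Runs.par (W := 35) (D := 35) (eval_reg hm)
    (fun j m => m = setRow s.mem Arr.Q l fun i =>
      if i = 2 * (2 ^ δ + j) then s.mem Arr.Q l (2 ^ δ + j)
      else if i = 2 * (2 ^ δ + j) + 1 then
        s.mem Arr.Q l (2 ^ δ + j) + s.mem Arr.T l (2 * (2 ^ δ + j))
      else s.mem Arr.Q l i) (fun j hj => ?_) fun mm hmm => ?_) (fun _ h => h) ?_ ?_
  · have hl' : (s.setReg Reg.i j).reg Reg.l = l := (setReg_of_ne _ _ (by decide)).trans hl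
    have hm' : (s.setReg Reg.i j).reg Reg.m = 2 ^ δ := (setReg_of_ne _ _ (by decide)).trans hm
    have hle {s' : State} (hs : s'.reg = (s.setReg Reg.i j).reg) :
        SortWT.l.eval w ω s' = l := eval_reg (hs ▸ hl')
    have hmi {s' : State} (hs : s'.reg = (s.setReg Reg.i j).reg) :
        (m + i).eval w ω s' = 2 ^ δ + j :=
      eval_add (eval_reg (hs ▸ hm')) (eval_reg (hs ▸ setReg_same _ _ _)) (by omega)
    have h2mi {s' : State} (hs : s'.reg = (s.setReg Reg.i j).reg) :
        (2 * (m + i)).eval w ω s' = 2 * (2 ^ δ + j) :=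
      eval_mul (eval_two hw2) (hmi hs) (by omega)
    have hq : ∀ v, (SortWT.get Arr.Q SortWT.l (m + i)).eval w ω
        ((s.setReg Reg.i j).setMem Arr.Q l (2 * (2 ^ δ + j)) v) = s.mem Arr.Q l (2 ^ δ + j) :=
      fun v => calc
        _ = ((s.setReg Reg.i j).setMem Arr.Q l (2 * (2 ^ δ + j)) v).mem Arr.Q l (2 ^ δ + j) :=
          eval_read (hle rfl) (hmi rfl)
        _ = _ := setMem_of_ne _ _ (by omega)
    have hT : ∀ v, (SortWT.get Arr.T SortWT.l (2 * (m + i))).eval w ω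
        ((s.setReg Reg.i j).setMem Arr.Q l (2 * (2 ^ δ + j)) v) =
        s.mem Arr.T l (2 * (2 ^ δ + j)) :=
      fun v => calc
        _ = ((s.setReg Reg.i j).setMem Arr.Q l (2 * (2 ^ δ + j)) v).mem Arr.T l (2 * (2 ^ δ + j)) :=
          eval_read (hle rfl) (h2mi rfl)
        _ = _ := setMem_of_ne _ _ (by simp)
    refine Runs.mono (Runs.write_seq (hle rfl) (h2mi rfl)
      (eval_read (hle rfl) (hmi rfl)) <|
      Runs.write (hle rfl) (eval_add (h2mi rfl) (eval_one hw2) (by omega))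
      (eval_add (hq _) (hT _) (hsum j hj)) ?_) (fun _ h => h) ?_ ?_
    · funext a r i
      simp only [State.setMem, State.setReg, setRow]
      by_cases har : a = Arr.Q ∧ r = l
      · obtain ⟨rfl, rfl⟩ := har
        simp only [true_and, and_self, if_true]
        split_ifs <;> first | rfl | omega
      · rw [if_neg (by tauto), if_neg (by tauto), if_neg har]
    all_goals simp only [size_one, size_two, size_reg, size_add, size_mul, size_read]; norm_num
  · have hcell : ∀ (v : ℕ) (x : ℕ), (∀ j < 2 ^ δ, v = 2 * (2 ^ δ + j) →
        s.mem Arr.Q l (2 ^ δ + j) = x) → (∀ j < 2 ^ δ, v = 2 * (2 ^ δ + j) + 1 →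
        s.mem Arr.Q l (2 ^ δ + j) + s.mem Arr.T l (2 * (2 ^ δ + j)) = x) →
        (s.mem Arr.Q l v = x ∨ ∃ j < 2 ^ δ, v = 2 * (2 ^ δ + j) ∨ v = 2 * (2 ^ δ + j) + 1) →
        mergeMem (2 ^ δ) s.mem mm Arr.Q l v = x := by
      intro v x h₁ h₂ h₃
      refine mergeMem_eq (fun j hj => ?_) (h₃.imp_right fun ⟨j, hj, h⟩ => ⟨j, hj, ?_⟩)
      · rw [hmm j hj, setRow_same]
        split_ifs with ha hb
        · exact .inr (h₁ j hj ha)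
        · exact .inr (h₂ j hj hb)
        · exact .inl rfl
      · rw [hmm j hj, setRow_same]
        rcases h with h | h
        · rw [if_pos h, h₁ j hj h]
        · rw [if_neg (by omega), if_pos h, h₂ j hj h]
    refine ⟨rfl, mergeMem (2 ^ δ) s.mem mm Arr.Q l, ?_, fun p hp => ⟨?_, ?_⟩, fun v hv => ?_⟩
    · funext a r i
      by_cases har : a = Arr.Q ∧ r = l
      · obtain ⟨rfl, rfl⟩ := har
        rw [setRow_same]
      · rw [setRow_of_ne _ _ _ har]
        exact mergeMem_eq_self fun j hj => by rw [hmm j hj, setRow_of_ne _ _ _ har]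
    · refine hcell _ _ (fun j hj h => ?_) (fun j hj h => by omega) (.inr ⟨p, hp, .inl rfl⟩)
      rw [show j = p by omega]
    · refine hcell _ _ (fun j hj h => by omega) (fun j hj h => ?_) (.inr ⟨p, hp, .inr rfl⟩)
      rw [show j = p by omega]
    · rw [pow_succ] at hv
      exact hcell _ _ (fun j hj h => by omega) (fun j hj h => by omega) (.inl rfl)
  all_goals simp only [size_reg]; omega

/-- The prefix sum; the command `leaf` writes the leaves `f 0, …, f (2 ^ t - 1)`, and `P` is the
sequence of their prefix sums. -/
theorem runs_prefixSum {leaf : Cmd} {n l t Wl Dl : ℕ} {f P : ℕ → ℕ} (hn : s.reg Reg.n = n)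
    (hl : s.reg Reg.l = l) (ht : Nat.clog 2 n = t) (hn2 : 2 ≤ n) (hw : 4 * n ≤ 2 ^ w)
    (hf : ∀ i, f i ≤ 1) (hP : ∀ k, P k = ∑ i ∈ Finset.range k, f i)
    (hleaf : ∀ s₁ : State, s₁.mem = s.mem → s₁.reg Reg.N = 2 ^ t →
      (∀ x, x ≠ Reg.N → s₁.reg x = s.reg x) →
      Runs w ω leaf s₁ (fun s₂ => s₂.reg = s₁.reg ∧ ∃ g, s₂.mem = setRow s.mem Arr.T l g ∧
        ∀ i < 2 ^ t, g (2 ^ t + i) = f i) Wl Dl) :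
    Runs w ω (prefixSum leaf) s (fun s' =>
        (∀ x, x ≠ Reg.N → x ≠ Reg.m → s'.reg x = s.reg x) ∧ s'.reg Reg.N = 2 ^ t ∧
        ∃ g q, s'.mem = setRow (setRow s.mem Arr.T l g) Arr.Q l q ∧
          (∀ i < 2 ^ t, g (2 ^ t + i) = f i ∧ q (2 ^ t + i) = P i) ∧ g 1 = P (2 ^ t))
      (200 * n + Wl) (130 * (t + 1) + Dl) := by
  have hpow : 2 ^ t < 2 * n := ht ▸ two_pow_clog_lt hn2
  have hle : t ≤ n := ht ▸ clog_le_self n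
  have hw2 : 2 < 2 ^ w := by omega
  have hPs : ∀ k, P (k + 1) = P k + f k := fun k => by
    rw [hP, hP, Finset.sum_range_succ]
  have hPk : ∀ k, P k ≤ k := by
    intro k
    induction k with
    | zero => simp [hP]
    | succ k ih => rw [hPs]; have := hf k; omega
  have hP0 : P 0 = 0 := by simp [hP]
  have hPle : ∀ d p, d ≤ t → p < 2 ^ d → P ((p + 1) * 2 ^ (t - d)) ≤ 2 ^ t := by
    intro d p hd hp
    refine (hPk _).trans ?_
    calc (p + 1) * 2 ^ (t - d) ≤ 2 ^ d * 2 ^ (t - d) := Nat.mul_le_mul_right _ hp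
      _ = 2 ^ t := by rw [← pow_add]; congr 1; omega
  have hdouble : Runs w ω (.while (.op .lt N SortWT.n) (.set Reg.N (N * 2))) (s.setReg Reg.N 1)
      (fun s₁ => s₁.mem = s.mem ∧ s₁.reg Reg.N = 2 ^ t ∧ ∀ x, x ≠ Reg.N → s₁.reg x = s.reg x)
      (4 + 8 * t) (4 + 8 * t) := by
    refine Runs.mono (Runs.while (D := 4) t (fun i s₁ => s₁.mem = s.mem ∧ s₁.reg Reg.N = 2 ^ i ∧
      ∀ x, x ≠ Reg.N → s₁.reg x = s.reg x) (fun _ => 4) ?_ ?_ ?_) (fun _ h => h) ?_ ?_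
    · exact ⟨rfl, setReg_same _ _ _, fun x h => setReg_of_ne _ _ h⟩
    · rintro i hi s' ⟨hm, hN, hx⟩
      have hi' : 2 ^ i < n := (Nat.lt_clog_iff_pow_lt (by norm_num)).1 (ht ▸ hi)
      have hn' : s'.reg Reg.n = n := by rw [hx _ (by decide), hn]
      refine ⟨by rw [eval_lt (eval_reg hN) (eval_reg hn') (by omega), if_pos hi']; simp, ?_⟩
      exact Runs.set (eval_mul (eval_reg hN) (eval_two hw2) (by omega))
        ⟨hm, setReg_same _ _ _, fun x h => (setReg_of_ne _ _ h).trans (hx x h)⟩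
    · rintro s' ⟨hm, hN, hx⟩
      have hn' : s'.reg Reg.n = n := by rw [hx _ (by decide), hn]
      refine ⟨?_, hm, hN, hx⟩
      rw [eval_lt (eval_reg hN) (eval_reg hn') (by omega), if_neg]
      exact not_lt.2 (ht ▸ Nat.le_pow_clog (by norm_num) _)
    all_goals
      simp only [size_reg, size_op, Finset.sum_const, Finset.card_range, smul_eq_mul]
      omega
  -- After `i` iterations the nodes of depth at least `t - i` are correct.
  have hup : ∀ s₂ : State, s₂.reg Reg.N = 2 ^ t → (∀ x, x ≠ Reg.N → s₂.reg x = s.reg x) →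
      ∀ g₀, s₂.mem = setRow s.mem Arr.T l g₀ → (∀ i < 2 ^ t, g₀ (2 ^ t + i) = f i) →
      Runs w ω (.while m (block [
        .par Reg.i m (
          .write Arr.T SortWT.l (m + i) (SortWT.get Arr.T SortWT.l (2 * (m + i)) +
            SortWT.get Arr.T SortWT.l (2 * (m + i) + 1))),
        .set Reg.m (m / 2)])) (s₂.setReg Reg.m (2 ^ t / 2))
      (fun s₃ => s₃.reg Reg.N = 2 ^ t ∧ (∀ x, x ≠ Reg.N → x ≠ Reg.m → s₃.reg x = s.reg x) ∧
        ∃ g, s₃.mem = setRow s.mem Arr.T l g ∧ (∀ i < 2 ^ t, g (2 ^ t + i) = f i) ∧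
          SumsBelow P g t 0) (2 + 8 * t + 24 * 2 ^ t) (2 + 32 * t) := by
    intro s₂ hN hx₂ g₀ hm₂ hg₀
    refine Runs.mono (Runs.while (D := 30) t (fun i s₃ => s₃.reg Reg.N = 2 ^ t ∧
      s₃.reg Reg.m = 2 ^ t / 2 ^ (i + 1) ∧
      (∀ x, x ≠ Reg.N → x ≠ Reg.m → s₃.reg x = s.reg x) ∧
        ∃ g, s₃.mem = setRow s.mem Arr.T l g ∧ (∀ i < 2 ^ t, g (2 ^ t + i) = f i) ∧
          SumsBelow P g t (t - i)) (fun i => 6 + 24 * 2 ^ (t - 1 - i)) ?_ ?_ ?_)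
      (fun _ h => h) ?_ ?_
    · refine ⟨?_, ?_, fun x h h' => ?_, g₀, hm₂, hg₀, fun d p hd hdt hp => ?_⟩
      · rw [setReg_of_ne _ _ (by decide), hN]
      · rw [setReg_same]; simp
      · rw [setReg_of_ne _ _ h', hx₂ x h]
      · obtain rfl : d = t := by omega
        rw [hg₀ p hp, Nat.sub_self, pow_zero, mul_one, mul_one, hPs, add_comm]
    · rintro i hi s₃ ⟨hN, hm, hx, g, hmem, hgf, hg⟩
      obtain ⟨δ, hδ⟩ : ∃ δ, t = δ + (i + 1) := ⟨t - (i + 1), by omega⟩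
      have e1 : t - 1 - i = δ := by omega
      have e2 : t - i = δ + 1 := by omega
      have e3 : t - (i + 1) = δ := by omega
      have hδt : 2 ^ (δ + 1) ≤ 2 ^ t := Nat.pow_le_pow_right (by norm_num) (by omega)
      have hδs : 2 ^ (δ + 1) = 2 * 2 ^ δ := by ring
      rw [hδ, Nat.pow_div (by omega) (by norm_num), Nat.add_sub_cancel] at hm
      have hl₃ : s₃.reg Reg.l = l := by rw [hx _ (by decide) (by decide), hl]
      rw [e2] at hg
      rw [e1, e3]
      have hmT : ∀ v, s₃.mem Arr.T l v = g v := fun v => by rw [hmem, setRow_same]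
      refine ⟨by rw [eval_reg hm]; positivity, ?_⟩
      refine Runs.mono (Runs.seq (W' := 4) (D' := 4)
        (runs_upLevel hl₃ hm (by omega) fun p hp => ?_) ?_) (fun _ h => h) (by omega) (by omega)
      · rw [hmT, hmT]
        have h3 := SumsBelow.pred hg (by omega)
          (g' := fun v => if v < 2 ^ (δ + 1) then g (2 * v) + g (2 * v + 1) else g v)
          (fun p hp => if_pos (by omega)) (fun v hv => if_neg (by omega)) δ p le_rfl (by omega) hp
        simp only at h3
        rw [if_pos (by omega)] at h3
        have := hPle δ p (by omega) hp
        omega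
      rintro s₄ ⟨hr, g', hmem', hg1, hg2⟩
      refine Runs.set (v := 2 ^ δ / 2) (eval_div (a := 2 ^ δ) (eval_reg ?_) (eval_two hw2)
          (by omega)) ⟨?_, ?_, fun x h h' => ?_, g', ?_, fun j hj => ?_, ?_⟩
      · rw [hr, hm]
      · rw [setReg_of_ne _ _ (by decide), hr, hN]
      · rw [setReg_same, hδ]
        rw [show 2 ^ (i + 1 + 1) = 2 ^ (i + 1) * 2 by ring, ← Nat.div_div_eq_div_mul,
          Nat.pow_div (by omega) (by norm_num), Nat.add_sub_cancel]
      · rw [setReg_of_ne _ _ h', hr, hx x h h']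
      · refine hmem'.trans ?_
        rw [hmem, setRow_setRow]
      · rw [hg2 _ (by omega), hmT, hgf j hj]
      · exact hg.pred (by omega) (fun p hp => by rw [hg1 p hp, hmT, hmT])
          (fun v hv => by rw [hg2 v hv, hmT])
    · rintro s₃ ⟨hN, hm, hx, g, hmem, hgf, hg⟩
      rw [Nat.sub_self] at hg
      refine ⟨?_, hN, hx, g, hmem, hgf, hg⟩
      rw [eval_reg hm]
      exact Nat.div_eq_of_lt (Nat.pow_lt_pow_right (by norm_num) (by omega))
    · have h3 : ∑ i ∈ Finset.range t, 2 ^ (t - 1 - i) = ∑ i ∈ Finset.range t, 2 ^ i :=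
        Finset.sum_range_reflect (fun i => 2 ^ i) t
      have h4 := sum_two_pow_lt t
      simp only [size_reg, Finset.sum_add_distrib, ← Finset.mul_sum, h3, Finset.sum_const,
        Finset.card_range, smul_eq_mul]
      omega
    · simp only [size_reg]; omega
  -- After `i` iterations the nodes of depth at most `i` are correct.
  have hdown : ∀ s₃ : State, s₃.reg Reg.N = 2 ^ t →
      (∀ x, x ≠ Reg.N → x ≠ Reg.m → s₃.reg x = s.reg x) →
      ∀ g, s₃.mem = setRow s.mem Arr.T l g → SumsBelow P g t 0 →
      Runs w ω (.while (.op .lt m N) (block [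
        .par Reg.i m (block [
          .write Arr.Q SortWT.l (2 * (m + i)) (SortWT.get Arr.Q SortWT.l (m + i)),
          .write Arr.Q SortWT.l (2 * (m + i) + 1) (SortWT.get Arr.Q SortWT.l (m + i) +
            SortWT.get Arr.T SortWT.l (2 * (m + i)))]),
        .set Reg.m (m * 2)])) ((s₃.setMem Arr.Q l 1 0).setReg Reg.m 1)
      (fun s₄ => s₄.reg Reg.N = 2 ^ t ∧ (∀ x, x ≠ Reg.N → x ≠ Reg.m → s₄.reg x = s.reg x) ∧
        ∃ q, s₄.mem = setRow (setRow s.mem Arr.T l g) Arr.Q l q ∧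
          ∀ i < 2 ^ t, q (2 ^ t + i) = P i) (4 + 10 * t + 36 * 2 ^ t) (4 + 46 * t) := by
    intro s₃ hN hx₃ g hm₃ hg
    refine Runs.mono (Runs.while (D := 42) t (fun i s₄ => s₄.reg Reg.N = 2 ^ t ∧
      s₄.reg Reg.m = 2 ^ i ∧ (∀ x, x ≠ Reg.N → x ≠ Reg.m → s₄.reg x = s.reg x) ∧
        ∃ q, s₄.mem = setRow (setRow s.mem Arr.T l g) Arr.Q l q ∧
          ∀ d p, d ≤ i → p < 2 ^ d → q (2 ^ d + p) = P (p * 2 ^ (t - d)))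
      (fun i => 6 + 36 * 2 ^ i) ?_ ?_ ?_) (fun _ h => h) ?_ ?_
    · refine ⟨?_, setReg_same _ _ _, fun x h h' => ?_, _,
        (setMem_mem s₃ Arr.Q l 1 0).trans (by rw [hm₃]), fun d p hd hp => ?_⟩
      · rw [setReg_of_ne _ _ (by decide)]; exact hN
      · rw [setReg_of_ne _ _ h']; exact hx₃ x h h'
      · obtain rfl : d = 0 := by omega
        obtain rfl : p = 0 := by simpa using hp
        simp [hP0]
    · rintro i hi s₄ ⟨hN, hm, hx, q, hmem, hq⟩
      have hit : 2 ^ (i + 1) ≤ 2 ^ t := Nat.pow_le_pow_right (by norm_num) (by omega)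
      have his : 2 ^ (i + 1) = 2 * 2 ^ i := by ring
      have hl₄ : s₄.reg Reg.l = l := by rw [hx _ (by decide) (by decide), hl]
      have hmQ : ∀ v, s₄.mem Arr.Q l v = q v := fun v => by rw [hmem, setRow_same]
      have hmT : ∀ v, s₄.mem Arr.T l v = g v := fun v => by
        rw [hmem, setRow_of_ne _ _ _ (by simp), setRow_same]
      have h0 : 0 < 2 ^ i := by positivity
      refine ⟨by rw [eval_lt (eval_reg hm) (eval_reg hN) (by omega), if_pos (by omega)]; simp, ?_⟩
      have hval : ∀ p < 2 ^ i, q (2 ^ i + p) = P (2 * p * 2 ^ (t - (i + 1))) ∧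
          q (2 ^ i + p) + g (2 * (2 ^ i + p)) = P ((2 * p + 1) * 2 ^ (t - (i + 1))) := by
        intro p hp
        have e1 : 2 * (2 ^ i + p) = 2 ^ (i + 1) + 2 * p := by ring
        have e2 : p * 2 ^ (t - i) = 2 * p * 2 ^ (t - (i + 1)) := by
          rw [show t - i = t - (i + 1) + 1 by omega]; ring
        have h3 := hg (i + 1) (2 * p) (Nat.zero_le _) (by omega) (by omega)
        rw [hq i p le_rfl hp, e1, e2]
        omega
      refine Runs.mono (Runs.seq (W' := 4) (D' := 4)
        (runs_downLevel hl₄ hm (by omega) fun p hp => ?_) ?_) (fun _ h => h) (by omega) (by omega)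
      · rw [hmQ, hmT, (hval p hp).2]
        have := hPle (i + 1) (2 * p) (by omega) (by omega)
        omega
      rintro s₅ ⟨hr, q', hmem', hq1, hq2⟩
      refine Runs.set (eval_mul (a := 2 ^ i) (eval_reg ?_) (eval_two hw2) (by omega))
          ⟨?_, ?_, fun x h h' => ?_, q', ?_, fun d p hd hp => ?_⟩
      · rw [hr, hm]
      · rw [setReg_of_ne _ _ (by decide), hr, hN]
      · rw [setReg_same, pow_succ]
      · rw [setReg_of_ne _ _ h', hr, hx x h h']
      · refine hmem'.trans ?_
        rw [hmem, setRow_setRow]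
      · rcases Nat.lt_or_ge d (i + 1) with hd' | hd'
        · have : 2 ^ (d + 1) ≤ 2 ^ (i + 1) := Nat.pow_le_pow_right (by norm_num) (by omega)
          rw [hq2 _ (by rw [pow_succ] at this; omega), hmQ]
          exact hq d p (by omega) hp
        · obtain rfl : d = i + 1 := by omega
          obtain ⟨p', rfl | rfl⟩ : ∃ p', p = 2 * p' ∨ p = 2 * p' + 1 := ⟨p / 2, by omega⟩
          · rw [show 2 ^ (i + 1) + 2 * p' = 2 * (2 ^ i + p') by ring,
              (hq1 p' (by omega)).1, hmQ, (hval p' (by omega)).1]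
          · rw [show 2 ^ (i + 1) + (2 * p' + 1) = 2 * (2 ^ i + p') + 1 by ring,
              (hq1 p' (by omega)).2, hmQ, hmT, (hval p' (by omega)).2]
    · rintro s₄ ⟨hN, hm, hx, q, hmem, hq⟩
      refine ⟨?_, hN, hx, q, hmem, fun i hi => ?_⟩
      · rw [eval_lt (eval_reg hm) (eval_reg hN) (by omega), if_neg (by omega)]
      · rw [hq t i le_rfl hi, Nat.sub_self, pow_zero, mul_one]
    · have h4 := sum_two_pow_lt t
      simp only [size_reg, size_op, Finset.sum_add_distrib, ← Finset.mul_sum, Finset.sum_const,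
        Finset.card_range, smul_eq_mul]
      omega
    · simp only [size_reg, size_op]; omega
  refine Runs.mono (Runs.set_seq (eval_one hw2) <| Runs.seq
    (W' := Wl + 18 + 18 * t + 60 * 2 ^ t) (D' := Dl + 18 + 78 * t) hdouble ?_)
    (fun _ h => h) ?_ ?_
  · rintro s₁ ⟨hm₁, hN₁, hx₁⟩
    refine Runs.mono (Runs.seq (W' := 18 + 18 * t + 60 * 2 ^ t) (D' := 18 + 78 * t)
      (hleaf s₁ hm₁ hN₁ hx₁) ?_) (fun _ h => h) (by omega) (by omega)
    rintro s₂ ⟨hr₂, g₀, hm₂, hg₀⟩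
    refine Runs.mono (Runs.set_seq (eval_div (a := 2 ^ t) (eval_reg (hr₂ ▸ hN₁)) (eval_two hw2)
      (by omega)) <| Runs.seq (W' := 10 + 10 * t + 36 * 2 ^ t) (D' := 10 + 46 * t)
      (hup s₂ (hr₂ ▸ hN₁) (hr₂ ▸ hx₁) g₀ hm₂ hg₀) ?_) (fun _ h => h) ?_ ?_
    · rintro s₃ ⟨hN₃, hx₃, g, hm₃, hgf, hg⟩
      have hl₃ : s₃.reg Reg.l = l := by rw [hx₃ _ (by decide) (by decide), hl]
      refine Runs.mono (Runs.write_seq (eval_reg hl₃) (eval_one hw2) eval_zero <|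
        Runs.set_seq (eval_one hw2) <| hdown s₃ hN₃ hx₃ g hm₃ hg) ?_ ?_ ?_
      · rintro s₄ ⟨hN₄, hx₄, q, hm₄, hq⟩
        refine ⟨hx₄, hN₄, g, q, hm₄, fun i hi => ⟨hgf i hi, hq i hi⟩, ?_⟩
        have := hg 0 0 le_rfl (Nat.zero_le _) (by norm_num)
        simpa [hP0] using this
      all_goals simp only [size_zero, size_one, size_reg]; omega
    all_goals simp only [size_two, size_reg, size_div]; omega
  all_goals simp only [size_one]; omega

/-! ### Segments of a sorted sequence -/

/-- `1` if the position `i < n` is the start of a segment of equal values of `u`, and `0`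
otherwise. -/
def startFlag (u : ℕ → ℕ) (n i : ℕ) : ℕ := if i < n ∧ (i = 0 ∨ u i ≠ u (i - 1)) then 1 else 0

/-- The number of segments of equal values of `u` that start before position `k`. -/
def startCount (u : ℕ → ℕ) (n k : ℕ) : ℕ := ∑ i ∈ Finset.range k, startFlag u n i

theorem startFlag_le_one (u : ℕ → ℕ) (n i : ℕ) : startFlag u n i ≤ 1 := by
  unfold startFlag; split_ifs <;> omega

theorem startCount_succ (u : ℕ → ℕ) (n k : ℕ) :
    startCount u n (k + 1) = startCount u n k + startFlag u n k := Finset.sum_range_succ _ _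

theorem startCount_mono (u : ℕ → ℕ) (n : ℕ) : Monotone (startCount u n) :=
  monotone_nat_of_le_succ fun k => by rw [startCount_succ]; omega

theorem startCount_le (u : ℕ → ℕ) (n k : ℕ) : startCount u n k ≤ k := by
  induction k with
  | zero => simp [startCount]
  | succ k ih => rw [startCount_succ]; have := startFlag_le_one u n k; omega

theorem startCount_of_le (u : ℕ → ℕ) {n k : ℕ} (h : n ≤ k) :
    startCount u n k = startCount u n n := by
  induction k, h using Nat.le_induction with
  | base => rfl
  | succ k hk ih => rw [startCount_succ, ih, startFlag, if_neg (by omega), add_zero]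

theorem startCount_lt {u : ℕ → ℕ} {n i k : ℕ} (h : startFlag u n i = 1) (hk : i < k) :
    startCount u n i < startCount u n k := by
  have h1 := startCount_succ u n i
  have h2 : startCount u n (i + 1) ≤ startCount u n k := startCount_mono u n hk
  omega

theorem startCount_inj {u : ℕ → ℕ} {n i j : ℕ} (hi : startFlag u n i = 1)
    (hj : startFlag u n j = 1) (h : startCount u n i = startCount u n j) : i = j := by
  rcases lt_trichotomy i j with hij | hij | hij
  · have := startCount_lt hi hij; omega
  · exact hij
  · have := startCount_lt hj hij; omega

theorem exists_startCount_eq {u : ℕ → ℕ} {n q : ℕ} (k : ℕ) (h : q < startCount u n k) :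
    ∃ i < k, startFlag u n i = 1 ∧ startCount u n i = q := by
  induction k with
  | zero => simp [startCount] at h
  | succ k ih =>
    rw [startCount_succ] at h
    have := startFlag_le_one u n k
    by_cases hq : q < startCount u n k
    · obtain ⟨i, hi, h'⟩ := ih hq
      exact ⟨i, by omega, h'⟩
    · exact ⟨k, by omega, by omega, by omega⟩

/-- The first `n` values of `u` are sorted, and the value `p` occupies the `len p` positions from
`x p` on. -/
def Segments (u : ℕ → ℕ) (n : ℕ) (x len : ℕ → ℕ) : Prop :=
  ∀ p, x p + len p ≤ n ∧ (∀ i < x p, u i < p) ∧ (∀ j < len p, u (x p + j) = p) ∧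
    ∀ i < n, x p + len p ≤ i → p < u i

namespace Segments

variable {u x len : ℕ → ℕ} {n p : ℕ} (h : Segments u n x len)
include h

theorem mem_segment {i : ℕ} (hi : i < n) : x (u i) ≤ i ∧ i < x (u i) + len (u i) := by
  obtain ⟨-, h1, -, h3⟩ := h (u i)
  constructor
  · by_contra hlt
    exact lt_irrefl _ (h1 i (by omega))
  · by_contra hlt
    exact lt_irrefl _ (h3 i hi (by omega))

theorem startFlag_start (hp : 0 < len p) : startFlag u n (x p) = 1 := by
  obtain ⟨h0, h1, h2, -⟩ := h p
  refine if_pos ⟨by omega, ?_⟩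
  rcases Nat.eq_zero_or_pos (x p) with hx | hx
  · exact .inl hx
  · have h3 := h1 (x p - 1) (by omega)
    have h4 := h2 0 hp
    rw [add_zero] at h4
    exact .inr (by omega)

theorem eq_start {i : ℕ} (hi : startFlag u n i = 1) : i < n ∧ i = x (u i) := by
  have hi' : i < n ∧ (i = 0 ∨ u i ≠ u (i - 1)) := by
    by_contra hne
    rw [startFlag, if_neg hne] at hi
    omega
  obtain ⟨hin, hi0⟩ := hi'
  obtain ⟨h1, h2⟩ := h.mem_segment hin
  refine ⟨hin, ?_⟩
  by_contra hne
  rcases hi0 with h0 | h0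
  · omega
  · obtain ⟨-, -, h3, -⟩ := h (u i)
    have h4 := h3 (i - 1 - x (u i)) (by omega)
    rw [show x (u i) + (i - 1 - x (u i)) = i - 1 by omega] at h4
    exact h0 h4.symm

theorem startCount_end (hp : 0 < len p) :
    startCount u n (x p + len p) = startCount u n (x p) + 1 := by
  have key : ∀ j, j + 1 ≤ len p → startCount u n (x p + (j + 1)) = startCount u n (x p) + 1 := by
    intro j
    induction j with
    | zero => intro _; rw [zero_add, startCount_succ, h.startFlag_start hp]
    | succ j ih =>
      intro hj
      rw [← add_assoc, startCount_succ, ih (by omega), startFlag, if_neg]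
      rintro ⟨-, h0 | h0⟩
      · omega
      · obtain ⟨-, -, h2, -⟩ := h p
        rw [h2 (j + 1) (by omega), show x p + (j + 1) - 1 = x p + j by omega,
          h2 j (by omega)] at h0
        exact h0 rfl
  obtain ⟨j, hj⟩ : ∃ j, len p = j + 1 := ⟨len p - 1, by omega⟩
  rw [hj]
  exact key j hj.ge

theorem startFlag_end (hp : 0 < len p) (hn : x p + len p < n) :
    startFlag u n (x p + len p) = 1 := by
  obtain ⟨-, -, h2, h3⟩ := h p
  refine if_pos ⟨hn, .inr ?_⟩
  have h4 := h3 _ hn le_rfl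
  have h5 := h2 (len p - 1) (by omega)
  rw [show x p + (len p - 1) = x p + len p - 1 by omega] at h5
  omega

end Segments

/-- In a list that is sorted by `κ`, the elements with `κ c = p` form a segment. -/
theorem eq_filter_append (κ : ℕ → ℕ) (p : ℕ) (T : List ℕ)
    (hT : T.Pairwise fun a b => κ a ≤ κ b) :
    T = T.filter (fun c => κ c < p) ++ (T.filter (fun c => κ c = p) ++
      T.filter (fun c => p < κ c)) := by
  induction T with
  | nil => rfl
  | cons a T ih =>
    rw [List.pairwise_cons] at hT
    have ih := ih hT.2
    rcases lt_trichotomy (κ a) p with h | h | h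
    · have h1 : ¬ κ a = p := by omega
      have h2 : ¬ p < κ a := by omega
      simp only [List.filter_cons, h, h1, h2, decide_true, decide_false, if_true,
        Bool.false_eq_true, if_false, List.cons_append]
      rw [← ih]
    · have h0 : T.filter (fun c => κ c < p) = [] := by
        rw [List.filter_eq_nil_iff]
        intro b hb
        have := hT.1 b hb
        simp; omega
      have h1 : ¬ κ a < p := by omega
      have h2 : ¬ p < κ a := by omega
      rw [h0] at ih
      simp only [List.filter_cons, h, h0, lt_irrefl, decide_true, decide_false, if_true,
        Bool.false_eq_true, if_false, List.cons_append, List.nil_append]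
      simp only [List.nil_append] at ih
      rw [← ih]
    · have h0 : T.filter (fun c => κ c < p) = [] := by
        rw [List.filter_eq_nil_iff]
        intro b hb
        have := hT.1 b hb
        simp; omega
      have h3 : T.filter (fun c => κ c = p) = [] := by
        rw [List.filter_eq_nil_iff]
        intro b hb
        have := hT.1 b hb
        simp; omega
      have h1 : ¬ κ a < p := by omega
      have h2 : ¬ κ a = p := by omega
      rw [h0, h3] at ih
      simp only [List.filter_cons, h, h0, h1, h2, h3, decide_true, decide_false, if_true,
        Bool.false_eq_true, if_false, List.nil_append]
      simp only [List.nil_append] at ih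
      rw [← ih]

/-- Stable sorting by `κ` keeps the order of the elements with `κ c = p`: their segment of the
sorted sequence is the subsequence of them of the input. -/
theorem IsStableSort.segments {seq : List ℕ} {κ key out : ℕ → ℕ}
    (hkey : ∀ i < seq.length, key i = κ (seq.getD i 0))
    (h : IsStableSort seq.length key (fun i => seq.getD i 0) out) :
    (∀ i < seq.length, out i ∈ seq) ∧ ∃ x : ℕ → ℕ,
      Segments (fun i => κ (out i)) seq.length x
        (fun p => (seq.filter fun c => κ c = p).length) ∧
      ∀ p, (List.range (seq.filter fun c => κ c = p).length).map (fun j => out (x p + j)) =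
        seq.filter fun c => κ c = p := by
  obtain ⟨π, hperm, hsort, hout⟩ := h
  set n := seq.length with hn
  set val : ℕ → ℕ := fun i => seq.getD i 0 with hval
  have hseq : (List.range n).map val = seq := by
    apply List.ext_getElem
    · simp [hn]
    · intro i h1 h2
      simp [hval, List.getD_eq_getElem?_getD, h2]
  have hπ : ∀ i ∈ π, i < n := fun i hi => List.mem_range.1 (hperm.mem_iff.1 hi)
  set T := (List.range n).map out with hT
  have hfilter : ∀ p, T.filter (fun c => κ c = p) = seq.filter fun c => κ c = p := by
    intro p
    have hpi : π.filter (fun i => κ (val i) = p) =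
        (List.range n).filter (fun i => κ (val i) = p) := by
      refine (hperm.filter _).eq_of_pairwise (le := fun i j => i < j)
        (fun a b _ _ h1 h2 => absurd h1 (not_lt.2 h2.le)) ?_ ?_
      · rw [List.pairwise_filter]
        refine hsort.imp_of_mem fun {a b} ha hb hab h1 h2 => ?_
        rw [hkey a (hπ a ha), hkey b (hπ b hb)] at hab
        simp only [decide_eq_true_eq] at h1 h2
        simp only [hval] at h1 h2
        omega
      · exact List.Pairwise.filter _ List.pairwise_lt_range
    rw [hout, List.filter_map, ← hseq, List.filter_map]
    exact congrArg (List.map val) hpi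
  have hsorted : T.Pairwise fun a b => κ a ≤ κ b := by
    rw [hout, List.pairwise_map]
    refine hsort.imp_of_mem fun {a b} ha hb hab => ?_
    rw [hkey a (hπ a ha), hkey b (hπ b hb)] at hab
    simp only [hval]
    omega
  have hget : ∀ i < n, T[i]? = some (out i) := fun i hi => by simp [hT, hi]
  refine ⟨fun i hi => ?_, fun p => (T.filter fun c => κ c < p).length, fun p => ?_, fun p => ?_⟩
  · have hmem : out i ∈ T := List.mem_of_getElem? (hget i hi)
    have := (List.mem_filter (p := fun c => decide (κ c = κ (out i)))).2 ⟨hmem, by simp⟩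
    rw [hfilter] at this
    exact (List.mem_filter.1 this).1
  all_goals
    have hsplit := eq_filter_append κ p T hsorted
    rw [hfilter p] at hsplit
    set A := T.filter fun c => κ c < p with hA
    set B := seq.filter fun c => κ c = p with hB
    set C := T.filter fun c => p < κ c with hC
    have hlen : n = A.length + (B.length + C.length) := by
      rw [← List.length_append, ← List.length_append, ← hsplit, hT, List.length_map,
        List.length_range]
    have hBget : ∀ j < B.length, B[j]? = some (out (A.length + j)) := by
      intro j hj
      rw [← hget _ (by omega), hsplit, List.getElem?_append_right (by omega),
        Nat.add_sub_cancel_left, List.getElem?_append_left hj]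
  · change A.length + B.length ≤ n ∧ (∀ i < A.length, κ (out i) < p) ∧
      (∀ j < B.length, κ (out (A.length + j)) = p) ∧
      ∀ i < n, A.length + B.length ≤ i → p < κ (out i)
    refine ⟨by omega, fun i hi => ?_, fun j hj => ?_, fun i hi hi' => ?_⟩
    · have h1 := hget i (by omega)
      rw [hsplit, List.getElem?_append_left hi] at h1
      simpa using (List.mem_filter.1 (List.mem_of_getElem? h1)).2
    · simpa using (List.mem_filter.1 (List.mem_of_getElem? (hBget j hj))).2
    · have h1 := hget i hi
      rw [hsplit, List.getElem?_append_right (by omega),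
        List.getElem?_append_right (by omega)] at h1
      simpa using (List.mem_filter.1 (List.mem_of_getElem? h1)).2
  · change (List.range B.length).map (fun j => out (A.length + j)) = B
    apply List.ext_getElem?
    intro j
    by_cases hj : j < B.length
    · rw [hBget j hj]; simp [hj]
    · rw [List.getElem?_eq_none (by simpa using hj), List.getElem?_eq_none (by simpa using hj)]

/-! ### The starts of the nodes of a level -/

/-- The filter.  `u i` is the key by which the symbol at position `i` of the sorted sequence has
been sorted.  The new content `o` of `O[l]` lists the starts of the segments of `u`, followed by `n`. -/
theorem runs_nodeStarts {n l L t : ℕ} {u : ℕ → ℕ} (hn : s.reg Reg.n = n) (hl : s.reg Reg.l = l)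
    (hL : s.reg Reg.L = L) (ht : Nat.clog 2 n = t) (hn2 : 2 ≤ n) (hw : 4 * n ≤ 2 ^ w)
    (hLw : L < 2 ^ w) (hS : ∀ i < n, s.mem Arr.S' l i < 2 ^ w)
    (hu : ∀ i < n, u i = s.mem Arr.S' l i / 2 ^ (L - l)) (hT : ∀ i, s.mem Arr.T l i = 0) :
    Runs w ω nodeStarts s (fun s' =>
        (∀ x, x ≠ Reg.N → x ≠ Reg.m → x ≠ Reg.cnt → s'.reg x = s.reg x) ∧
        s'.reg Reg.cnt = startCount u n n ∧
        ∃ g q o, s'.mem = setRow (setRow (setRow s.mem Arr.T l g) Arr.Q l q) Arr.O l o ∧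
          (∀ i < n, startFlag u n i = 1 → o (startCount u n i) = i) ∧ o (startCount u n n) = n)
      (260 * n) (200 * (t + 1)) := by
  have hpow : 2 ^ t < 2 * n := ht ▸ two_pow_clog_lt hn2
  have hle : n ≤ 2 ^ t := ht ▸ Nat.le_pow_clog (by norm_num) _
  have hw2 : 2 < 2 ^ w := by omega
  have hleaf : ∀ s₁ : State, s₁.mem = s.mem → s₁.reg Reg.N = 2 ^ t →
      (∀ x, x ≠ Reg.N → s₁.reg x = s.reg x) →
      Runs w ω (.par Reg.i SortWT.n (
        .ite i
          (.ite (.op .eq (SortWT.get Arr.S' SortWT.l i >>> (SortWT.L - SortWT.l))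
              (SortWT.get Arr.S' SortWT.l (i - 1) >>> (SortWT.L - SortWT.l)))
            (.write Arr.T SortWT.l (N + i) 0)
            (.write Arr.T SortWT.l (N + i) 1))
          (.write Arr.T SortWT.l (N + i) 1))) s₁
        (fun s₂ => s₂.reg = s₁.reg ∧ ∃ g, s₂.mem = setRow s.mem Arr.T l g ∧
          ∀ i < 2 ^ t, g (2 ^ t + i) = startFlag u n i) (27 * n + 2) 29 := by
    intro s₁ hm hN hx
    refine Runs.mono (Runs.par_row (W := 26) (D := 26) (k := n) (a := Arr.T) (r := l)
      (Q := fun s₂ => s₂.reg = s₁.reg ∧ ∃ g, s₂.mem = setRow s.mem Arr.T l g ∧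
          ∀ i < 2 ^ t, g (2 ^ t + i) = startFlag u n i)
      (fun j => 2 ^ t + j) (startFlag u n) (fun i => if 2 ^ t ≤ i then startFlag u n (i - 2 ^ t)
        else s.mem Arr.T l i) (eval_reg ((hx _ (by decide)).trans hn)) (fun j hj => ?_)
      (fun j hj => ?_) (fun i hi => ?_) ⟨rfl, _, by rw [hm], fun i hi => ?_⟩)
      (fun _ h => h) ?_ ?_
    · set s₂ := s₁.setReg Reg.i j with hs₂
      have hx₂ : ∀ x, x ≠ Reg.N → x ≠ Reg.i → s₂.reg x = s.reg x := fun x h h' => by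
        rw [hs₂, setReg_of_ne _ _ h', hx x h]
      have hi₂ : SortWT.i.eval w ω s₂ = j := eval_reg (setReg_same _ _ _)
      have hl₂ : SortWT.l.eval w ω s₂ = l := eval_reg ((hx₂ _ (by decide) (by decide)).trans hl)
      have hL₂ : SortWT.L.eval w ω s₂ = L := eval_reg ((hx₂ _ (by decide) (by decide)).trans hL)
      have hN₂ : SortWT.N.eval w ω s₂ = 2 ^ t :=
        eval_reg ((setReg_of_ne _ _ (by decide)).trans hN)
      have hNi := eval_add hN₂ hi₂ (by omega)
      have hLl := eval_sub hL₂ hl₂ (by omega)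
      have hm₂ : s₂.mem = s.mem := hm
      refine Runs.mono (Runs.ite (W := 24) (D := 24) hi₂ (fun h => ?_) (fun h => ?_))
        (fun _ h => h) ?_ ?_
      · have hcmp := eval_eq (eval_shiftRight (eval_read (k := Arr.S') hl₂ hi₂) hLl
            (by rw [hm₂]; exact hS j hj))
          (eval_shiftRight (eval_read (k := Arr.S') hl₂
            (eval_sub hi₂ (eval_one hw2) (by omega))) hLl
            (by rw [hm₂]; exact hS (j - 1) (by omega))) (by omega)
        rw [hm₂, ← hu j hj, ← hu (j - 1) (by omega)] at hcmp
        refine Runs.mono (Runs.ite (W := 6) (D := 6) hcmp (fun h' => ?_) (fun h' => ?_))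
          (fun _ h => h) ?_ ?_
        · have h0 : startFlag u n j = 0 := by
            refine if_neg ?_
            rintro ⟨-, h0 | h0⟩
            · exact h h0
            · simp [h0] at h'
          refine Runs.mono (Runs.write hl₂ hNi eval_zero ?_) (fun _ h => h) ?_ ?_
          · rw [h0]; rfl
          all_goals simp only [size_zero, size_reg, size_add]; norm_num
        · have h1 : startFlag u n j = 1 := by
            refine if_pos ⟨hj, .inr fun h0 => ?_⟩
            simp [h0] at h'
          refine Runs.mono (Runs.write hl₂ hNi (eval_one hw2) ?_) (fun _ h => h) ?_ ?_
          · rw [h1]; rfl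
          all_goals simp only [size_one, size_reg, size_add]; norm_num
        all_goals
          simp only [size_one, size_reg, size_op, size_shr, size_sub, size_read]; norm_num
      · have h1 : startFlag u n j = 1 := if_pos ⟨hj, .inl h⟩
        refine Runs.mono (Runs.write hl₂ hNi (eval_one hw2) ?_) (fun _ h => h) ?_ ?_
        · rw [h1]; rfl
        all_goals simp only [size_one, size_reg, size_add]; norm_num
      all_goals simp only [size_reg]; norm_num
    · rw [if_pos (by omega), Nat.add_sub_cancel_left]
    · split_ifs with h
      · rw [hm, hT, startFlag, if_neg]
        rintro ⟨h1, -⟩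
        exact hi _ h1 (by omega)
      · rw [hm]
    · rw [if_pos (by omega), Nat.add_sub_cancel_left]
    all_goals simp only [size_reg]; omega
  refine Runs.mono (Runs.seq (W' := 15 * n + 10) (D' := 40)
    (runs_prefixSum hn hl ht hn2 hw (startFlag_le_one u n) (fun k => rfl) hleaf) ?_)
    (fun _ h => h) (by omega) (by omega)
  rintro s₁ ⟨hx, hN, g, q, hmem, hgq, hg1⟩
  have hmT : ∀ v, s₁.mem Arr.T l v = g v := fun v => by
    rw [hmem, setRow_of_ne _ _ _ (by simp), setRow_same]
  have hmQ : ∀ v, s₁.mem Arr.Q l v = q v := fun v => by rw [hmem, setRow_same]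
  have hl₁ : s₁.reg Reg.l = l := (hx _ (by decide) (by decide)).trans hl
  have hn₁ : s₁.reg Reg.n = n := (hx _ (by decide) (by decide)).trans hn
  refine Runs.mono (Runs.seq (W' := 8) (D' := 8) (R := fun s₂ => s₂.reg = s₁.reg ∧
    ∃ o, s₂.mem = setRow s₁.mem Arr.O l o ∧
      ∀ i < n, startFlag u n i = 1 → o (startCount u n i) = i)
    (Runs.par (W := 14) (D := 14) (eval_reg hn₁) (fun j m => if startFlag u n j = 0 then m = s₁.mem
      else m = (s₁.setMem Arr.O l (startCount u n j) j).mem) (fun j hj => ?_) ?_) ?_)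
    (fun _ h => h) ?_ ?_
  · set s₂ := s₁.setReg Reg.i j with hs₂
    have hl₂ : SortWT.l.eval w ω s₂ = l := eval_reg ((setReg_of_ne _ _ (by decide)).trans hl₁)
    have hi₂ : SortWT.i.eval w ω s₂ = j := eval_reg (setReg_same _ _ _)
    have hN₂ : SortWT.N.eval w ω s₂ = 2 ^ t := eval_reg ((setReg_of_ne _ _ (by decide)).trans hN)
    have hNi := eval_add hN₂ hi₂ (by omega)
    have hT₂ : (SortWT.get Arr.T SortWT.l (N + i)).eval w ω s₂ = startFlag u n j :=
      (eval_read hl₂ hNi).trans ((hmT _).trans (hgq j (by omega)).1)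
    have hQ₂ : (SortWT.get Arr.Q SortWT.l (N + i)).eval w ω s₂ = startCount u n j :=
      (eval_read hl₂ hNi).trans ((hmQ _).trans (hgq j (by omega)).2)
    refine Runs.mono (Runs.ite (W := 8) (D := 8) hT₂ (fun h => ?_) (fun h => ?_))
      (fun _ h => h) ?_ ?_
    · refine Runs.mono (Runs.write hl₂ hQ₂ hi₂ ?_) (fun _ h => h) ?_ ?_
      · rw [if_neg h]; rfl
      all_goals simp only [size_reg, size_add, size_read]; norm_num
    · refine Runs.mono (Runs.skip ?_) (fun _ h => h) ?_ ?_
      · rw [if_pos h]; rfl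
      all_goals norm_num
    all_goals simp only [size_reg, size_add, size_read]; norm_num
  · intro mm hmm
    refine ⟨rfl, mergeMem n s₁.mem mm Arr.O l, ?_, fun i hi hflag => ?_⟩
    · funext a r v
      by_cases har : a = Arr.O ∧ r = l
      · obtain ⟨rfl, rfl⟩ := har
        rw [setRow_same]
      · rw [setRow_of_ne _ _ _ har]
        refine mergeMem_eq_self fun j hj => ?_
        have := hmm j hj
        split_ifs at this
        · rw [this]
        · rw [this, setMem_of_ne _ _ (by tauto)]
    · refine mergeMem_eq (fun j hj => ?_) (.inr ⟨i, hi, ?_⟩)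
      · have h1 := hmm j hj
        have h2 := startFlag_le_one u n j
        split_ifs at h1 with h0
        · exact .inl (by rw [h1])
        · by_cases hc : startCount u n i = startCount u n j
          · have hij := startCount_inj hflag (by omega) hc
            rw [h1, hij, setMem_same]
            exact .inr rfl
          · rw [h1, setMem_of_ne _ _ (by tauto)]
            exact .inl rfl
      · have h1 := hmm i hi
        rw [if_neg (by omega)] at h1
        rw [h1, setMem_same]
  · rintro s₂ ⟨hr, o, hmem₂, ho⟩
    have hcnt : g 1 = startCount u n n := hg1.trans (startCount_of_le u hle)
    have hT₂ : (SortWT.get Arr.T SortWT.l 1).eval w ω s₂ = startCount u n n :=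
      (eval_read (eval_reg (hr ▸ hl₁)) (eval_one hw2)).trans <| by
        rw [hmem₂, setRow_of_ne _ _ _ (by simp), hmT, hcnt]
    refine Runs.mono (Runs.set_seq hT₂ <| Runs.write (ρ := l) (v := n)
      (eval_reg ?_) (eval_reg (setReg_same _ _ _)) (eval_reg ?_) ?_) (fun _ h => h) ?_ ?_
    · rw [setReg_of_ne _ _ (by decide), hr, hl₁]
    · rw [setReg_of_ne _ _ (by decide), hr, hn₁]
    · refine ⟨fun x h h' h'' => ?_, setReg_same s₂ Reg.cnt _, g, q,
        Function.update o (startCount u n n) n, ?_, fun i hi hflag => ?_, ?_⟩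
      · refine (setReg_of_ne _ _ h'').trans ?_
        rw [hr, hx x h h']
      · rw [setMem_mem]
        have : (s₂.setReg Reg.cnt (startCount u n n)).mem = s₂.mem := rfl
        rw [this, hmem₂, setRow_setRow, hmem]
        congr 1
        funext v
        rw [Function.update_apply, Function.update_apply, setRow_same]
      · rw [Function.update_of_ne (startCount_lt hflag hi).ne, ho i hi hflag]
      · exact Function.update_self _ _ _
    all_goals simp only [size_one, size_reg, size_read]; norm_num
  all_goals simp only [size_reg]; omega

/-! ### A level of the wavelet tree -/

/-- The nodes on level `l` of the wavelet tree of `seq` are stored in the memory.  The node number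
`p` holds the symbols whose top `l` of `L` bits are `p`; if there are none, only its length
is prescribed. -/
def StoresLevel (seq : List ℕ) (L l : ℕ) (m : Mem) : Prop :=
  ∀ p < 2 ^ l,
    m Arr.Len 0 (2 ^ l - 1 + p) = (seq.filter fun c => c / 2 ^ (L - l) = p).length ∧
    (List.range (seq.filter fun c => c / 2 ^ (L - l) = p).length).map
        (fun j => m Arr.B l (m Arr.Ptr 0 (2 ^ l - 1 + p) + j)) =
      (seq.filter fun c => c / 2 ^ (L - l) = p).map fun c => (c.testBit (L - (l + 1))).toNat

/-- The arrays of the wavelet tree are zero outside the part that belongs to level `l`. -/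
def ZeroOffLevel (l : ℕ) (m : Mem) : Prop :=
  (∀ r, r ≠ l → ∀ i, m Arr.B r i = 0) ∧
  ∀ i, i < 2 ^ l - 1 ∨ 2 ^ (l + 1) - 1 ≤ i → m Arr.Ptr 0 i = 0 ∧ m Arr.Len 0 i = 0

/-- The initial memory, with the input `seq`. -/
def InputMem (seq : List ℕ) (m : Mem) : Prop :=
  (∀ i, m Arr.S 0 i = seq.getD i 0) ∧ ∀ a r i, a ≠ Arr.S → m a r i = 0

theorem and_two_pow_ne_zero (c k : ℕ) :
    (if c &&& 2 ^ k ≠ 0 then 1 else 0) = (c.testBit k).toNat := by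
  rw [Nat.and_two_pow]
  cases c.testBit k <;> simp

theorem getD_mem {seq : List ℕ} {i : ℕ} (hi : i < seq.length) : seq.getD i 0 ∈ seq := by
  rw [List.getD_eq_getElem?_getD]
  simp [hi]

theorem map_range_getD (seq : List ℕ) (f : ℕ → ℕ) :
    (List.range seq.length).map (fun j => f (seq.getD j 0)) = seq.map f := by
  apply List.ext_getElem
  · simp
  · intro i h1 h2
    simp only [List.length_map] at h2
    simp [List.getD_eq_getElem?_getD, h2]

theorem runs_levelZero {seq : List ℕ} {L : ℕ} (hn : s.reg Reg.n = seq.length)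
    (hl : s.reg Reg.l = 0) (hmask : s.reg Reg.mask = 2 ^ (L - (0 + 1)))
    (hmaskw : 2 ^ (L - (0 + 1)) < 2 ^ w) (hw2 : 2 < 2 ^ w) (hseq : ∀ c ∈ seq, c < 2 ^ L)
    (hmem : InputMem seq s.mem) :
    Runs w ω (block [fillBitmap Arr.S 0, .write Arr.Ptr 0 0 0, .write Arr.Len 0 0 SortWT.n]) s
      (fun s' => ZeroOffLevel 0 s'.mem ∧ StoresLevel seq L 0 s'.mem)
      (12 * (seq.length + 1) + 8) 22 := by
  refine Runs.mono (Runs.seq (W' := 8) (D' := 8)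
    (runs_fillBitmap hn hl hmask hmaskw hw2 (fun j => eval_zero) rfl) ?_) (fun _ h => h)
    le_rfl le_rfl
  rintro s₁ rfl
  refine Runs.mono (Runs.write_seq eval_zero eval_zero eval_zero <|
    Runs.write eval_zero eval_zero (eval_reg hn) ?_) (fun _ h => h) ?_ ?_
  · have hB : ∀ r i, (((⟨s.reg, setRow s.mem Arr.B 0 fun i => if i < seq.length then
        (if s.mem Arr.S 0 i &&& 2 ^ (L - (0 + 1)) ≠ 0 then 1 else 0) else s.mem Arr.B 0 i⟩ :
        State).setMem Arr.Ptr 0 0 0).setMem Arr.Len 0 0 seq.length).mem Arr.B r i =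
        if r = 0 ∧ i < seq.length then ((seq.getD i 0).testBit (L - (0 + 1))).toNat else 0 := by
      intro r i
      rw [setMem_of_ne _ _ (by simp), setMem_of_ne _ _ (by simp)]
      simp only [and_two_pow_ne_zero, hmem.1, hmem.2 Arr.B _ _ (by decide)]
      by_cases hr : r = 0
      · subst hr
        rw [setRow_same]
        simp
      · rw [setRow_of_ne _ _ _ (by tauto), hmem.2 _ _ _ (by decide), if_neg (by tauto)]
    refine ⟨⟨fun r hr i => ?_, fun i hi => ?_⟩, fun p hp => ?_⟩
    · rw [hB, if_neg (by tauto)]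
    · have hi : i ≠ 0 := by
        rintro rfl
        simp at hi
      simp [State.setMem, setRow, hi, hmem.2]
    · obtain rfl : p = 0 := by simpa using hp
      have hfil : seq.filter (fun c => c / 2 ^ (L - 0) = 0) = seq := by
        rw [List.filter_eq_self]
        intro c hc
        simpa using Nat.div_eq_of_lt (hseq c hc)
      rw [hfil]
      refine ⟨by simp [State.setMem], ?_⟩
      refine (List.map_congr_left fun j hj => ?_).trans (map_range_getD seq _)
      rw [hB, setMem_of_ne _ _ (by simp)]
      simp only [pow_zero, Nat.sub_self, add_zero, setMem_same, zero_add]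
      rw [if_pos ⟨trivial, List.mem_range.1 hj⟩]
  all_goals simp only [size_zero, size_reg]; norm_num

/-- The last loop of a level; `x p` and `len p` are the start and the length of the segment of
the node number `p`. -/
theorem runs_storeNodes {l L n q : ℕ} {x len : ℕ → ℕ} (hl : s.reg Reg.l = l)
    (hL : s.reg Reg.L = L) (hcnt : s.reg Reg.cnt = q) (hw : 4 * n ≤ 2 ^ w) (hLw : L < 2 ^ w)
    (hlw : 2 ^ l ≤ 2 * n) (hn2 : 2 ≤ n) (hqn : q ≤ n) (hS : ∀ i < n, s.mem Arr.S' l i < 2 ^ w)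
    (hxn : ∀ p, x p + len p ≤ n) (node : ℕ → ℕ)
    (hq : ∀ j < q, node j < 2 ^ l ∧ 0 < len (node j) ∧ s.mem Arr.O l j = x (node j) ∧
      s.mem Arr.O l (j + 1) = x (node j) + len (node j) ∧
      s.mem Arr.S' l (x (node j)) / 2 ^ (L - l) = node j)
    (hsurj : ∀ p < 2 ^ l, 0 < len p → ∃ j < q, node j = p)
    (hzero : ∀ i, s.mem Arr.Ptr 0 i = 0 ∧ s.mem Arr.Len 0 i = 0) :
    Runs w ω (.par Reg.i cnt (block [
          .set Reg.node ((1 : Expr) <<< SortWT.l - 1 +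
            (SortWT.get Arr.S' SortWT.l (SortWT.get Arr.O SortWT.l i) >>>
              (SortWT.L - SortWT.l))),
          .write Arr.Ptr 0 SortWT.node (SortWT.get Arr.O SortWT.l i),
          .write Arr.Len 0 SortWT.node (SortWT.get Arr.O SortWT.l (i + 1) -
            SortWT.get Arr.O SortWT.l i)])) s
      (fun s' => (∀ r i, s'.mem Arr.B r i = s.mem Arr.B r i) ∧
        (∀ i, i < 2 ^ l - 1 ∨ 2 ^ (l + 1) - 1 ≤ i →
          s'.mem Arr.Ptr 0 i = 0 ∧ s'.mem Arr.Len 0 i = 0) ∧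
        ∀ p < 2 ^ l, s'.mem Arr.Len 0 (2 ^ l - 1 + p) = len p ∧
          (0 < len p → s'.mem Arr.Ptr 0 (2 ^ l - 1 + p) = x p)) (2 + 35 * n) 37 := by
  have hw2 : 2 < 2 ^ w := by omega
  have h1l : 1 ≤ 2 ^ l := Nat.one_le_two_pow
  refine Runs.mono (Runs.par (W := 34) (D := 34) (eval_reg hcnt)
    (fun j m => m = setRow (setRow s.mem Arr.Ptr 0 (Function.update (s.mem Arr.Ptr 0)
      (2 ^ l - 1 + node j) (x (node j)))) Arr.Len 0 (Function.update (s.mem Arr.Len 0)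
      (2 ^ l - 1 + node j) (len (node j)))) (fun j hj => ?_) fun mm hmm => ?_) (fun _ h => h) ?_ ?_
  · obtain ⟨h1, h2, h3, h4, h5⟩ := hq j hj
    have hx := hxn (node j)
    set s₁ := s.setReg Reg.i j with hs₁
    set s₂ := s₁.setReg Reg.node (2 ^ l - 1 + node j) with hs₂
    have hl₁ : SortWT.l.eval w ω s₁ = l := eval_reg ((setReg_of_ne _ _ (by decide)).trans hl)
    have hL₁ : SortWT.L.eval w ω s₁ = L := eval_reg ((setReg_of_ne _ _ (by decide)).trans hL)
    have hi₁ : SortWT.i.eval w ω s₁ = j := eval_reg (setReg_same _ _ _)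
    have hO₁ : (SortWT.get Arr.O SortWT.l i).eval w ω s₁ = x (node j) :=
      (eval_read hl₁ hi₁).trans h3
    have hnode : ((1 : Expr) <<< SortWT.l - 1 + (SortWT.get Arr.S' SortWT.l
        (SortWT.get Arr.O SortWT.l i) >>> (SortWT.L - SortWT.l))).eval w ω s₁ =
        2 ^ l - 1 + node j := by
      have ha := eval_sub (eval_one_shiftLeft hl₁ (by omega)) (eval_one hw2) (by omega)
      have hb := eval_shiftRight (eval_read (k := Arr.S') hl₁ hO₁) (eval_sub hL₁ hl₁ (by omega))
        (hS _ (by omega))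
      have hb' := hb.trans h5
      exact eval_add ha hb' (by omega)
    have hl₂ {s' : State} (h : s'.reg = s₂.reg) : SortWT.l.eval w ω s' = l := by
      refine eval_reg ?_
      rw [h, hs₂, setReg_of_ne _ _ (by decide), hs₁, setReg_of_ne _ _ (by decide), hl]
    have hi₂ {s' : State} (h : s'.reg = s₂.reg) : SortWT.i.eval w ω s' = j := by
      refine eval_reg ?_
      rw [h, hs₂, setReg_of_ne _ _ (by decide), hs₁, setReg_same]
    have hnode₂ {s' : State} (h : s'.reg = s₂.reg) :
        SortWT.node.eval w ω s' = 2 ^ l - 1 + node j := by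
      refine eval_reg ?_
      rw [h, hs₂, setReg_same]
    have hO₂ {s' : State} (h : s'.reg = s₂.reg) (hm : s'.mem Arr.O l = s.mem Arr.O l) :
        (SortWT.get Arr.O SortWT.l i).eval w ω s' = x (node j) :=
      (eval_read (hl₂ h) (hi₂ h)).trans (by rw [hm, h3])
    have hO₂' {s' : State} (h : s'.reg = s₂.reg) (hm : s'.mem Arr.O l = s.mem Arr.O l) :
        (SortWT.get Arr.O SortWT.l (i + 1)).eval w ω s' = x (node j) + len (node j) :=
      (eval_read (hl₂ h) (eval_add (hi₂ h) (eval_one hw2) (by omega))).trans (by rw [hm, h4])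
    have hm₃ : ∀ v u, (s₂.setMem Arr.Ptr 0 v u).mem Arr.O l = s.mem Arr.O l := fun v u => by
      funext i
      exact setMem_of_ne _ _ (by simp)
    refine Runs.mono (Runs.set_seq hnode <| Runs.write_seq eval_zero (hnode₂ rfl) (hO₂ rfl rfl) <|
      Runs.write eval_zero (hnode₂ rfl) (eval_sub (hO₂' rfl (hm₃ _ _)) (hO₂ rfl (hm₃ _ _))
      (by omega)) ?_) (fun _ h => h) ?_ ?_
    · rw [Nat.add_sub_cancel_left, setMem_mem, setMem_mem]
      congr 2
    all_goals
      simp only [size_zero, size_one, size_reg, size_add, size_sub, size_shl, size_shr, size_read]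
      norm_num
  · have hother : ∀ a r i, ¬ (a = Arr.Ptr ∧ r = 0) → ¬ (a = Arr.Len ∧ r = 0) →
        mergeMem q s.mem mm a r i = s.mem a r i := fun a r i h h' =>
      mergeMem_eq_self fun j hj => by
        rw [hmm j hj, setRow_of_ne _ _ _ h', setRow_of_ne _ _ _ h]
    have hP : ∀ j < q, ∀ i, mm j Arr.Ptr 0 i =
        if i = 2 ^ l - 1 + node j then x (node j) else 0 := fun j hj i => by
      rw [hmm j hj, setRow_of_ne _ _ _ (by simp), setRow_same, Function.update_apply, (hzero i).1]
    have hLen : ∀ j < q, ∀ i, mm j Arr.Len 0 i =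
        if i = 2 ^ l - 1 + node j then len (node j) else 0 := fun j hj i => by
      rw [hmm j hj, setRow_same, Function.update_apply, (hzero i).2]
    refine ⟨fun r i => hother _ _ _ (by simp) (by simp), fun i hi => ⟨?_, ?_⟩,
      fun p hp => ⟨?_, fun hp0 => ?_⟩⟩
    · refine (mergeMem_eq_self fun j hj => ?_).trans (hzero i).1
      have := (hq j hj).1
      rw [hP j hj, (hzero i).1, if_neg (by rw [pow_succ] at hi; omega)]
    · refine (mergeMem_eq_self fun j hj => ?_).trans (hzero i).2
      have := (hq j hj).1
      rw [hLen j hj, (hzero i).2, if_neg (by rw [pow_succ] at hi; omega)]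
    · refine mergeMem_eq (fun j hj => ?_) ?_
      · rw [hLen j hj, (hzero _).2]
        split_ifs with h
        · rw [show node j = p by omega]; exact .inr rfl
        · exact .inl rfl
      · rcases Nat.eq_zero_or_pos (len p) with h0 | h0
        · exact .inl (by rw [(hzero _).2, h0])
        · obtain ⟨j, hj, rfl⟩ := hsurj p hp h0
          exact .inr ⟨j, hj, by rw [hLen j hj, if_pos rfl]⟩
    · refine mergeMem_eq (fun j hj => ?_) ?_
      · rw [hP j hj, (hzero _).1]
        split_ifs with h
        · rw [show node j = p by omega]; exact .inr rfl
        · exact .inl rfl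
      · obtain ⟨j, hj, rfl⟩ := hsurj p hp hp0
        exact .inr ⟨j, hj, by rw [hP j hj, if_pos rfl]⟩
  all_goals simp only [size_reg]; omega

/-- A level other than the root level. -/
theorem runs_levelSucc {P : Cmd} {seq : List ℕ} {n L l t Ws Ds : ℕ} (hlen : seq.length = n)
    (hn : s.reg Reg.n = n) (hl : s.reg Reg.l = l) (hL : s.reg Reg.L = L)
    (hmask : s.reg Reg.mask = 2 ^ (L - (l + 1))) (ht : Nat.clog 2 n = t) (hn2 : 2 ≤ n)
    (hw : 4 * n ≤ 2 ^ w) (hlL : l < L) (hLn : 2 ^ L ≤ 2 * n) (hseq : ∀ c ∈ seq, c < 2 ^ L)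
    (hmem : InputMem seq s.mem)
    (hP : Runs w ω P (sortInput n (fun i => seq.getD i 0 / 2 ^ (L - l)) fun i => seq.getD i 0)
      (fun s' => IsStableSort n (fun i => seq.getD i 0 / 2 ^ (L - l)) (fun i => seq.getD i 0)
        (s'.mem 2 0)) Ws Ds) :
    Runs w ω (block [
        .par Reg.i SortWT.n (.write Arr.K SortWT.l i
          (SortWT.get Arr.S 0 i >>> (SortWT.L - SortWT.l))),
        .call P SortWT.n Arr.K SortWT.l Arr.S 0 Arr.S' SortWT.l,
        fillBitmap Arr.S' SortWT.l,
        nodeStarts,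
        .par Reg.i cnt (block [
          .set Reg.node ((1 : Expr) <<< SortWT.l - 1 +
            (SortWT.get Arr.S' SortWT.l (SortWT.get Arr.O SortWT.l i) >>>
              (SortWT.L - SortWT.l))),
          .write Arr.Ptr 0 SortWT.node (SortWT.get Arr.O SortWT.l i),
          .write Arr.Len 0 SortWT.node (SortWT.get Arr.O SortWT.l (i + 1) -
            SortWT.get Arr.O SortWT.l i)])]) s
      (fun s' => ZeroOffLevel l s'.mem ∧ StoresLevel seq L l s'.mem)
      (380 * n + Ws) (340 * (t + 1) + Ds) := by
  have hw2 : 2 < 2 ^ w := by omega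
  have hLw : L < 2 ^ w := lt_of_lt_of_le Nat.lt_two_pow_self (by omega)
  have hlpow : 2 ^ l ≤ 2 ^ L := Nat.pow_le_pow_right (by norm_num) hlL.le
  have hmaskw : 2 ^ (L - (l + 1)) ≤ 2 ^ L := Nat.pow_le_pow_right (by norm_num) (by omega)
  have hseqw : ∀ i < n, seq.getD i 0 < 2 ^ L := fun i hi => hseq _ (getD_mem (hlen ▸ hi))
  have hkeys := Runs.par_row (c := .write Arr.K SortWT.l i
      (SortWT.get Arr.S 0 i >>> (SortWT.L - SortWT.l))) (x := Reg.i) (e := SortWT.n) (ω := ω)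
    (W := 10) (D := 10) (k := n) (a := Arr.K) (r := l) (s := s) id
    (fun i => seq.getD i 0 / 2 ^ (L - l))
    (fun i => if i < n then seq.getD i 0 / 2 ^ (L - l) else s.mem Arr.K l i) (eval_reg hn)
    (fun j hj => by
      have hi₁ : SortWT.i.eval w ω (s.setReg Reg.i j) = j := eval_reg (setReg_same _ _ _)
      have hl₁ : SortWT.l.eval w ω (s.setReg Reg.i j) = l :=
        eval_reg ((setReg_of_ne _ _ (by decide)).trans hl)
      have hL₁ : SortWT.L.eval w ω (s.setReg Reg.i j) = L :=
        eval_reg ((setReg_of_ne _ _ (by decide)).trans hL)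
      have hr : (SortWT.get Arr.S 0 i).eval w ω (s.setReg Reg.i j) = seq.getD j 0 :=
        (eval_read eval_zero hi₁).trans (hmem.1 j)
      have := hseqw j hj
      refine Runs.mono (Runs.write hl₁ hi₁ (eval_shiftRight hr (eval_sub hL₁ hl₁ (by omega))
        (by omega)) ?_) (fun _ h => h) ?_ ?_
      · rfl
      all_goals simp only [size_zero, size_reg, size_shr, size_sub, size_read]; norm_num)
    (fun j hj => if_pos hj) (fun i hi => if_neg fun hin => hi i hin rfl)
    (Q := fun s₁ => s₁ = ⟨s.reg, setRow s.mem Arr.K l fun i =>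
      if i < n then seq.getD i 0 / 2 ^ (L - l) else s.mem Arr.K l i⟩) rfl
  refine Runs.mono (Runs.seq (W' := 350 * n + 30 + Ws) (D' := 200 * (t + 1) + 70 + Ds) hkeys ?_)
    (fun _ h => h) (by simp only [size_reg]; omega) (by simp only [size_reg]; omega)
  rintro s₁ rfl
  refine Runs.mono (Runs.seq (W' := 340 * n + 20) (D' := 200 * (t + 1) + 60)
    (Runs.call (Q := fun s₂ => s₂.reg = s.reg ∧ ∃ out, IsStableSort n
      (fun i => seq.getD i 0 / 2 ^ (L - l)) (fun i => seq.getD i 0) out ∧ ∃ gk gs,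
      s₂.mem = setRow (setRow s.mem Arr.K l gk) Arr.S' l gs ∧ ∀ i < n, gs i = out i)
      (eval_reg hn) (fun i hi => ?_) (fun i hi => ?_) (eval_reg hl) hP fun s' hs' =>
        ⟨rfl, s'.mem 2 0, hs', _, _, rfl, fun i hi => if_pos hi⟩) ?_)
    (fun _ h => h) ?_ ?_
  · have hl' : SortWT.l.eval w ω (⟨s.reg, setRow s.mem Arr.K l fun i =>
      if i < n then seq.getD i 0 / 2 ^ (L - l) else s.mem Arr.K l i⟩ : State) = l := eval_reg hl
    rw [hl']
    dsimp only
    rw [setRow_same, if_pos hi]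
  · rw [eval_zero]
    dsimp only
    rw [setRow_of_ne _ _ _ (by simp), hmem.1]
  rotate_left
  · simp only [size_reg, size_zero]; omega
  · simp only [size_reg, size_zero]; omega
  rintro s₂ ⟨hr₂, out, hsort, gk, gs, hmem₂, hgs⟩
  subst hlen
  set n := seq.length with hnn
  obtain ⟨hout, x, hseg, hlist⟩ := hsort.segments (κ := fun c => c / 2 ^ (L - l)) (fun i _ => rfl)
  set len : ℕ → ℕ := fun p => (seq.filter fun c => c / 2 ^ (L - l) = p).length with hlenp
  have hS₂ : ∀ i < n, s₂.mem Arr.S' l i = out i := fun i hi => by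
    rw [hmem₂, setRow_same, hgs i hi]
  have houtw : ∀ i < n, out i < 2 ^ L := fun i hi => hseq _ (hout i hi)
  refine Runs.mono (Runs.seq (W' := 325 * n + 5) (D' := 200 * (t + 1) + 45)
    (runs_fillBitmap (ρ := l) (hr₂ ▸ hn) (hr₂ ▸ hl) (hr₂ ▸ hmask) (by omega) hw2
      (fun j => eval_reg ?_) rfl) ?_) (fun _ h => h) (by omega) (by omega)
  · rw [setReg_of_ne _ _ (by decide), hr₂, hl]
  rintro s₃ hs₃
  have hr₃ : s₃.reg = s.reg := by rw [hs₃, ← hr₂]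
  have hm₃ : s₃.mem = setRow s₂.mem Arr.B l fun i =>
    if i < n then (if s₂.mem Arr.S' l i &&& 2 ^ (L - (l + 1)) ≠ 0 then 1 else 0)
      else s₂.mem Arr.B l i := by rw [hs₃]
  clear hs₃
  have hS₃ : ∀ i < n, s₃.mem Arr.S' l i = out i := fun i hi => by
    rw [hm₃, setRow_of_ne _ _ _ (by simp), hS₂ i hi]
  have hB₃ : ∀ i < n, s₃.mem Arr.B l i = ((out i).testBit (L - (l + 1))).toNat := fun i hi => by
    rw [hm₃, setRow_same, if_pos hi, and_two_pow_ne_zero, hS₂ i hi]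
  have hz₃ : ∀ a r i, a ≠ Arr.S → ¬ (a = Arr.K ∧ r = l) → ¬ (a = Arr.S' ∧ r = l) →
      ¬ (a = Arr.B ∧ r = l) → s₃.mem a r i = 0 := fun a r i h h1 h2 h3 => by
    rw [hm₃, setRow_of_ne _ _ _ h3, hmem₂, setRow_of_ne _ _ _ h2, setRow_of_ne _ _ _ h1,
      hmem.2 a r i h]
  refine Runs.mono (Runs.seq (W' := 2 + 35 * n) (D' := 37)
    (runs_nodeStarts (u := fun i => out i / 2 ^ (L - l)) (hr₃ ▸ hn) (hr₃ ▸ hl) (hr₃ ▸ hL) ht hn2 hw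
      hLw (fun i hi => ?_) (fun i hi => ?_) fun i => hz₃ _ _ _ (by decide) (by simp) (by simp)
        (by simp)) ?_)
    (fun _ h => h) (by omega) (by omega)
  · rw [hS₃ i hi]
    have := houtw i hi
    omega
  · simp only [hS₃ i hi]
  rintro s₄ ⟨hx₄, hcnt, g, q, o, hmem₄, ho, hon⟩
  set u : ℕ → ℕ := fun i => out i / 2 ^ (L - l) with hu
  have hul : ∀ i < n, u i < 2 ^ l := fun i hi => by
    refine Nat.div_lt_of_lt_mul ?_
    rw [← pow_add, Nat.sub_add_cancel hlL.le]
    exact houtw i hi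
  have hkeep : ∀ a r i, ¬ (a = Arr.T ∧ r = l) → ¬ (a = Arr.Q ∧ r = l) → ¬ (a = Arr.O ∧ r = l) →
      s₄.mem a r i = s₃.mem a r i := fun a r i h h' h'' => by
    rw [hmem₄, setRow_of_ne _ _ _ h'', setRow_of_ne _ _ _ h', setRow_of_ne _ _ _ h]
  have hO₄ : ∀ i, s₄.mem Arr.O l i = o i := fun i => by rw [hmem₄, setRow_same]
  -- The `j`-th start is that of the segment of some value `node j`.
  have hnode : ∀ j < startCount u n n, ∃ p, 0 < len p ∧ p < 2 ^ l ∧ j = startCount u n (x p) ∧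
      u (x p) = p := fun j hj => by
    obtain ⟨i, hi, hf, rfl⟩ := exists_startCount_eq n hj
    obtain ⟨-, hxi⟩ := hseg.eq_start hf
    have := hseg.mem_segment hi
    exact ⟨u i, by omega, hul i hi, by rw [← hxi], by rw [← hxi]⟩
  choose! node hnode1 hnode2 hnode3 hnode4 using hnode
  have hoend : ∀ p, 0 < len p → o (startCount u n (x p) + 1) = x p + len p := fun p hp => by
    have h1 := (hseg p).1
    have h2 := hseg.startCount_end hp
    rw [← h2]
    rcases Nat.lt_or_ge (x p + len p) n with h | h
    · exact ho _ h (hseg.startFlag_end hp h)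
    · have : x p + len p = n := le_antisymm h1 h
      change o (startCount u n (x p + len p)) = x p + len p
      rw [this, hon]
  have hxlt : ∀ p, 0 < len p → x p < n := fun p hp => by
    have := (hseg p).1; omega
  refine Runs.mono (runs_storeNodes (n := n) (x := x) (len := len)
    ((hx₄ _ (by decide) (by decide) (by decide)).trans (hr₃ ▸ hl))
    ((hx₄ _ (by decide) (by decide) (by decide)).trans (hr₃ ▸ hL)) hcnt hw hLw (by omega) hn2
    (startCount_le _ _ _) (fun i hi => ?_) (fun p => (hseg p).1) node (fun j hj => ?_)
    (fun p hp hp0 => ?_) (fun i => ⟨?_, ?_⟩)) ?_ le_rfl le_rfl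
  · rw [hkeep _ _ _ (by simp) (by simp) (by simp), hS₃ i hi]
    have := houtw i hi
    omega
  · have hp := hnode1 j hj
    refine ⟨hnode2 j hj, hp, ?_, ?_, ?_⟩
    · rw [hO₄]
      conv_lhs => rw [hnode3 j hj]
      exact ho _ (hxlt _ hp) (hseg.startFlag_start hp)
    · rw [hO₄]
      conv_lhs => rw [hnode3 j hj]
      exact hoend _ hp
    · rw [hkeep _ _ _ (by simp) (by simp) (by simp), hS₃ _ (hxlt _ hp)]
      exact hnode4 j hj
  · have hf := hseg.startFlag_start hp0
    have hj := startCount_lt hf (hxlt p hp0)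
    refine ⟨startCount u n (x p), hj, ?_⟩
    have h1 := startCount_inj hf (hseg.startFlag_start (hnode1 _ hj)) (hnode3 _ hj)
    rw [← hnode4 _ hj, ← h1]
    simpa using (hseg p).2.2.1 0 hp0
  · rw [hkeep _ _ _ (by simp) (by simp) (by simp)]
    exact hz₃ _ _ _ (by decide) (by simp) (by simp) (by simp)
  · rw [hkeep _ _ _ (by simp) (by simp) (by simp)]
    exact hz₃ _ _ _ (by decide) (by simp) (by simp) (by simp)
  · rintro s₅ ⟨hB, hzero, hstore⟩
    refine ⟨⟨fun r hr i => ?_, hzero⟩, fun p hp => ⟨(hstore p hp).1, ?_⟩⟩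
    · rw [hB, hkeep _ _ _ (by simp) (by simp) (by simp)]
      exact hz₃ _ _ _ (by decide) (by simp) (by simp) (by simp [hr])
    · refine Eq.trans ?_ (congrArg (List.map fun c => (c.testBit (L - (l + 1))).toNat) (hlist p))
      rw [List.map_map]
      refine List.map_congr_left fun j hj => ?_
      have hj' : j < len p := List.mem_range.1 hj
      have h1 : x p + len p ≤ n := (hseg p).1
      rw [hB, (hstore p hp).2 (by omega), hkeep _ _ _ (by simp) (by simp) (by simp),
        hB₃ _ (by omega)]
      rfl

/-! ### The wavelet tree -/

theorem storesTree_of_storesLevel {seq : List ℕ} {L : ℕ} {m : Mem}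
    (hlevel : ∀ l < L, StoresLevel seq L l m) (hlen : ∀ i, 2 ^ L - 1 ≤ i → m Arr.Len 0 i = 0)
    (k : ℕ) : ∀ l p, l + k = L → p < 2 ^ l →
      StoresTree m l (2 ^ l - 1 + p)
        (waveletTree k (p * 2 ^ k) (seq.filter fun c => c / 2 ^ k = p)) := by
  induction k with
  | zero =>
    rintro l p rfl hp
    exact hlen _ (by simp)
  | succ k ih =>
    intro l p hl hp
    have h1l : 1 ≤ 2 ^ l := Nat.one_le_two_pow
    obtain ⟨h1, h2⟩ := hlevel l (by omega) p hp
    rw [show L - l = k + 1 by omega, show L - (l + 1) = k by omega] at h2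
    rw [show L - l = k + 1 by omega] at h1
    rw [waveletTree]
    split_ifs with hnil
    · rw [hnil] at h1
      exact h1
    have hdiv : ∀ c, c / 2 ^ (k + 1) = c / 2 ^ k / 2 := fun c => by
      rw [pow_succ, Nat.div_div_eq_div_mul]
    have hpos : 0 < 2 ^ k := by positivity
    have hupper : ∀ c, p * 2 ^ (k + 1) + 2 ^ k ≤ c ↔ 2 * p + 1 ≤ c / 2 ^ k := fun c => by
      rw [Nat.le_div_iff_mul_le hpos]
      ring_nf
    have hleft : (seq.filter fun c => c / 2 ^ (k + 1) = p).filter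
        (fun c => c < p * 2 ^ (k + 1) + 2 ^ k) = seq.filter fun c => c / 2 ^ k = 2 * p := by
      rw [List.filter_filter]
      refine List.filter_congr fun c _ => ?_
      rw [← Bool.decide_and, decide_eq_decide, ← not_le, hupper, hdiv]
      omega
    have hright : (seq.filter fun c => c / 2 ^ (k + 1) = p).filter
        (fun c => p * 2 ^ (k + 1) + 2 ^ k ≤ c) = seq.filter fun c => c / 2 ^ k = 2 * p + 1 := by
      rw [List.filter_filter]
      refine List.filter_congr fun c _ => ?_
      rw [← Bool.decide_and, decide_eq_decide, hupper, hdiv]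
      omega
    rw [hleft, hright]
    refine ⟨by rw [h1, List.length_map], ?_, ?_, ?_⟩
    · rw [List.length_map, h2, List.map_map]
      refine List.map_congr_left fun c hc => ?_
      have hc := (List.mem_filter.1 hc).2
      simp only [decide_eq_true_eq] at hc
      simp only [Function.comp_apply]
      congr 1
      rw [Nat.testBit_eq_decide_div_mod_eq, decide_eq_decide, hupper]
      rw [hdiv] at hc
      omega
    · have := ih (l + 1) (2 * p) (by omega) (by rw [pow_succ]; omega)
      rw [show 2 ^ (l + 1) - 1 + 2 * p = 2 * (2 ^ l - 1 + p) + 1 by rw [pow_succ]; omega,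
        show 2 * p * 2 ^ k = p * 2 ^ (k + 1) by ring] at this
      exact this
    · have := ih (l + 1) (2 * p + 1) (by omega) (by rw [pow_succ]; omega)
      rw [show 2 ^ (l + 1) - 1 + (2 * p + 1) = 2 * (2 ^ l - 1 + p) + 2 by rw [pow_succ]; omega,
        show (2 * p + 1) * 2 ^ k = p * 2 ^ (k + 1) + 2 ^ k by ring] at this
      exact this

/-- If the sort `P` works on the keys of every level, with work `Ws` and depth `Ds`, then sortWT
stores the wavelet tree. -/
theorem runs_sortWT {P : Cmd} {seq : List ℕ} {σ n L t Ws Ds : ℕ} (hlen : seq.length = n)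
    (hσ : 2 ≤ σ) (hσn : σ ≤ n) (hL : Nat.clog 2 σ = L) (ht : Nat.clog 2 n = t)
    (hw : 4 * n ≤ 2 ^ w) (hseq : ∀ c ∈ seq, c < σ)
    (hP : ∀ l < L, 0 < l →
      Runs w ω P (sortInput n (fun i => seq.getD i 0 / 2 ^ (L - l)) fun i => seq.getD i 0)
      (fun s' => IsStableSort n (fun i => seq.getD i 0 / 2 ^ (L - l)) (fun i => seq.getD i 0)
        (s'.mem 2 0)) Ws Ds) :
    Runs w ω (sortWT P) (wtInput seq σ)
      (fun s' => StoresTree s'.mem 0 0 (waveletTree L 0 seq))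
      (12 * (L + 1) + (2 + L * (1 + (400 * n + Ws))))
      (12 * (L + 1) + (3 + (400 * (t + 1) + Ds))) := by
  have hpow : 2 ^ L < 2 * σ := hL ▸ two_pow_clog_lt hσ
  have hle : σ ≤ 2 ^ L := hL ▸ Nat.le_pow_clog (by norm_num) _
  have hLw : L < 2 ^ w := lt_of_lt_of_le Nat.lt_two_pow_self (by omega)
  have hw2 : 2 < 2 ^ w := by omega
  have hseq' : ∀ c ∈ seq, c < 2 ^ L := fun c hc => (hseq c hc).trans_le hle
  have hinput : InputMem seq (wtInput seq σ).mem :=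
    ⟨fun i => by simp [wtInput], fun a r i h => by simp [wtInput, h]⟩
  have hlevels : Runs w ω levels (wtInput seq σ) _ _ _ := runs_levels (σ := σ) rfl hσ (by omega)
  rw [hL] at hlevels
  refine Runs.mono (Runs.seq (D' := 3 + (400 * (t + 1) + Ds))
    (W' := 2 + L * (1 + (400 * n + Ws))) hlevels ?_) (fun _ h => h) le_rfl le_rfl
  rintro s₁ ⟨hm₁, hL₁, hx₁⟩
  have hn₁ : s₁.reg Reg.n = n := (hx₁ _ (by decide) (by decide)).trans hlen
  refine Runs.mono (Runs.par (W := 400 * n + Ws) (D := 400 * (t + 1) + Ds) (eval_reg hL₁)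
    (fun l m => ZeroOffLevel l m ∧ StoresLevel seq L l m) (fun l hl => ?_) fun mm hmm => ?_)
    (fun _ h => h) ?_ ?_
  · set s₂ := s₁.setReg Reg.l l with hs₂
    have hl₂ : SortWT.l.eval w ω s₂ = l := eval_reg (setReg_same _ _ _)
    have hL₂ : SortWT.L.eval w ω s₂ = L := eval_reg ((setReg_of_ne _ _ (by decide)).trans hL₁)
    have hmaskw : 2 ^ (L - (l + 1)) ≤ 2 ^ L := Nat.pow_le_pow_right (by norm_num) (by omega)
    have hmask := eval_one_shiftLeft
      (eval_sub hL₂ (eval_add hl₂ (eval_one hw2) (by omega)) (by omega)) (by omega)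
    set s₃ := s₂.setReg Reg.mask (2 ^ (L - (l + 1))) with hs₃
    have hx₃ : ∀ x, x ≠ Reg.mask → x ≠ Reg.l → s₃.reg x = s₁.reg x := fun x h h' => by
      rw [hs₃, setReg_of_ne _ _ h, hs₂, setReg_of_ne _ _ h']
    have hl₃ : s₃.reg Reg.l = l := (setReg_of_ne _ _ (by decide)).trans hl₂
    have hn₃ : s₃.reg Reg.n = n := (hx₃ _ (by decide) (by decide)).trans hn₁
    have hL₃ : s₃.reg Reg.L = L := (hx₃ _ (by decide) (by decide)).trans hL₁
    have hmask₃ : s₃.reg Reg.mask = 2 ^ (L - (l + 1)) := setReg_same _ _ _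
    have hm₃ : InputMem seq s₃.mem := by
      have : s₃.mem = s₁.mem := rfl
      rw [this, hm₁]
      exact hinput
    refine Runs.mono (Runs.set_seq hmask <| Runs.ite (W := 380 * n + 20 + Ws)
      (D := 340 * (t + 1) + 22 + Ds)
      (eval_eq (eval_reg hl₃) eval_zero (by omega)) (fun h => ?_) (fun h => ?_))
      (fun _ h => h) ?_ ?_
    · obtain rfl : l = 0 := by
        by_contra hne
        simp [hne] at h
      exact Runs.mono (runs_levelZero (hn₃.trans hlen.symm) hl₃ hmask₃ (by omega) hw2 hseq' hm₃)
        (fun _ h => h) (by omega) (by omega)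
    · have hl0 : 0 < l := by
        by_contra hne
        simp [show l = 0 by omega] at h
      exact Runs.mono (runs_levelSucc hlen hn₃ hl₃ hL₃ hmask₃ ht (by omega) hw hl (by omega) hseq'
        hm₃ (hP l hl hl0)) (fun _ h => h) (by omega) (by omega)
    all_goals
      simp only [size_zero, size_one, size_reg, size_op, size_shl, size_sub, size_add]
      omega
  · -- A cell that belongs to level `l` has been changed by the iteration for this level only.
    have hmerge : ∀ l < L, ∀ a r i, a ≠ Arr.S → (∀ j < L, j ≠ l → mm j a r i = 0) →
        mergeMem L s₁.mem mm a r i = mm l a r i := fun l hl a r i ha h => by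
      have h0 : s₁.mem a r i = 0 := by rw [hm₁]; exact hinput.2 a r i ha
      refine mergeMem_eq (fun j hj => ?_) (.inr ⟨l, hl, rfl⟩)
      by_cases hjl : j = l
      · exact .inr (by rw [hjl])
      · exact .inl ((h j hj hjl).trans h0.symm)
    have hB : ∀ l < L, ∀ i, mergeMem L s₁.mem mm Arr.B l i = mm l Arr.B l i := fun l hl i =>
      hmerge l hl _ _ _ (by decide) fun j hj hjl => (hmm j hj).1.1 l (Ne.symm hjl) i
    have hid : ∀ l, ∀ p < 2 ^ l, ∀ j, j ≠ l →
        2 ^ l - 1 + p < 2 ^ j - 1 ∨ 2 ^ (j + 1) - 1 ≤ 2 ^ l - 1 + p := fun l p hp j hjl => by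
      rcases Nat.lt_or_gt_of_ne hjl with h | h
      · have : 2 ^ (j + 1) ≤ 2 ^ l := Nat.pow_le_pow_right (by norm_num) h
        omega
      · have h1 : 2 ^ (l + 1) ≤ 2 ^ j := Nat.pow_le_pow_right (by norm_num) h
        have h2 : 1 ≤ 2 ^ l := Nat.one_le_two_pow
        rw [pow_succ] at h1
        omega
    have hPtr : ∀ l < L, ∀ p < 2 ^ l, mergeMem L s₁.mem mm Arr.Ptr 0 (2 ^ l - 1 + p) =
        mm l Arr.Ptr 0 (2 ^ l - 1 + p) := fun l hl p hp =>
      hmerge l hl _ _ _ (by decide) fun j hj hjl => ((hmm j hj).1.2 _ (hid l p hp j hjl)).1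
    have hLen : ∀ l < L, ∀ p < 2 ^ l, mergeMem L s₁.mem mm Arr.Len 0 (2 ^ l - 1 + p) =
        mm l Arr.Len 0 (2 ^ l - 1 + p) := fun l hl p hp =>
      hmerge l hl _ _ _ (by decide) fun j hj hjl => ((hmm j hj).1.2 _ (hid l p hp j hjl)).2
    have htree := storesTree_of_storesLevel (seq := seq) (L := L) (m := mergeMem L s₁.mem mm)
      (fun l hl p hp => ?_) (fun i hi => ?_) L 0 0 (zero_add L) (by norm_num)
    · have hfil : seq.filter (fun c => c / 2 ^ L = 0) = seq := by
        rw [List.filter_eq_self]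
        intro c hc
        simpa using Nat.div_eq_of_lt (hseq' c hc)
      rw [hfil, zero_mul] at htree
      exact htree
    · rw [hLen l hl p hp, hPtr l hl p hp]
      simp only [hB l hl]
      exact (hmm l hl).2 p hp
    · have h0 : s₁.mem Arr.Len 0 i = 0 := by rw [hm₁]; exact hinput.2 _ _ _ (by decide)
      refine (mergeMem_eq_self fun j hj => ?_).trans h0
      have h1 : 2 ^ (j + 1) ≤ 2 ^ L := Nat.pow_le_pow_right (by norm_num) hj
      rw [h0, ((hmm j hj).1.2 i (.inr (by omega))).2]
  all_goals simp only [size_reg]; omega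

/-! ### The bounds -/

theorem clog_le_two_mul_logb {n : ℕ} (hn : 2 ≤ n) : (Nat.clog 2 n : ℝ) ≤ 2 * Real.logb 2 n := by
  have hn0 : (0 : ℝ) < n := by exact_mod_cast (by omega : 0 < n)
  have h1 : (1 : ℝ) ≤ Real.logb 2 n := by
    rw [Real.le_logb_iff_rpow_le (by norm_num) hn0, Real.rpow_one]
    exact_mod_cast hn
  have h0 := Nat.clog_pos (b := 2) (by norm_num) hn
  have h2 : ((Nat.clog 2 n - 1 : ℕ) : ℝ) ≤ Real.logb 2 n := by
    rw [Real.le_logb_iff_rpow_le (by norm_num) hn0, Real.rpow_natCast]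
    exact_mod_cast (Nat.pow_pred_clog_lt_self (b := 2) (by norm_num) (x := n) (by omega)).le
  rw [Nat.cast_sub h0, Nat.cast_one] at h2
  linarith

/-- If every sort of a level is within the bounds, then so is sortWT. -/
theorem buildsWithin_of_sortsWithin {w n₀ σ : ℕ} {ω : ℕ → Fin (2 ^ w)} {P : Cmd} {C : ℝ}
    {seq : List ℕ} (hw : 4 * (Nat.log 2 seq.length + 1) ≤ w) (hσ : 2 ≤ σ) (hσn : σ ≤ seq.length)
    (hseq : ∀ c ∈ seq, c < σ)
    (hP : ∀ l < Nat.clog 2 σ, SortsWithin w ω P C n₀ seq.length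
      (fun i => seq.getD i 0 / 2 ^ (Nat.clog 2 σ - l)) fun i => seq.getD i 0) :
    BuildsWithin w ω P (2000 + 2 * max C 0) (max n₀ 4) seq σ := by
  obtain ⟨n, hn⟩ : ∃ n, seq.length = n := ⟨_, rfl⟩
  obtain ⟨L, hL⟩ : ∃ L, Nat.clog 2 σ = L := ⟨_, rfl⟩
  rw [BuildsWithin]
  rw [hn] at hw hσn
  rw [hn, hL] at hP ⊢
  have hw' : 4 * n ≤ 2 ^ w := by
    have h1 := Nat.lt_pow_succ_log_self (b := 2) (by norm_num) n
    have h2 : 2 ^ (Nat.log 2 n + 1 + 2) ≤ 2 ^ w := Nat.pow_le_pow_right (by norm_num) (by omega)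
    rw [pow_add] at h2
    omega
  set C₁ := max C 0 with hC₁
  have hC0 : 0 ≤ C₁ := le_max_right _ _
  have hCC : C ≤ C₁ := le_max_left _ _
  set y := Real.logb 2 n with hy
  set z := Real.logb 2 y with hz
  have hyz : 4 ≤ n → 2 ≤ y ∧ 1 ≤ z := fun h4 => by
    have h1 : 2 ≤ y := by
      rw [hy, Real.le_logb_iff_rpow_le (by norm_num) (by exact_mod_cast (by omega : 0 < n))]
      norm_num
      exact_mod_cast h4
    refine ⟨h1, ?_⟩
    rw [hz, Real.le_logb_iff_rpow_le (by norm_num) (by linarith), Real.rpow_one]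
    exact h1
  -- Below `max n₀ 4` only termination matters, so any common bounds for the levels will do.
  obtain ⟨Ws, Ds, hruns, hbound⟩ : ∃ Ws Ds : ℕ, (∀ l < L, Runs w ω P
      (sortInput n (fun i => seq.getD i 0 / 2 ^ (L - l)) fun i => seq.getD i 0)
      (fun s' => IsStableSort n (fun i => seq.getD i 0 / 2 ^ (L - l)) (fun i => seq.getD i 0)
        (s'.mem 2 0)) Ws Ds) ∧
      (max n₀ 4 ≤ n → (Ws : ℝ) ≤ C₁ * (n * z) ∧ (Ds : ℝ) ≤ C₁ * y) := by
    by_cases hn₀ : max n₀ 4 ≤ n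
    · obtain ⟨h2y, h1z⟩ := hyz (le_trans (le_max_right _ _) hn₀)
      refine ⟨⌊C₁ * (n * z)⌋₊, ⌊C₁ * y⌋₊, fun l hl => ?_, fun _ =>
        ⟨Nat.floor_le (by positivity), Nat.floor_le (by positivity)⟩⟩
      obtain ⟨f, o, h1, h2, h3⟩ := hP l hl
      obtain ⟨h3, h4⟩ := h3 (le_trans (le_max_left _ _) hn₀)
      refine ⟨f, o, h1, h2, Nat.le_floor (h3.trans ?_), Nat.le_floor (h4.trans ?_)⟩
      · exact mul_le_mul_of_nonneg_right hCC (by positivity)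
      · refine mul_le_mul hCC (div_le_self (by linarith) h1z) ?_ hC0
        exact div_nonneg (by linarith) (by linarith)
    · have hex : ∀ l, ∃ W D : ℕ, l < L → Runs w ω P
          (sortInput n (fun i => seq.getD i 0 / 2 ^ (L - l)) fun i => seq.getD i 0)
          (fun s' => IsStableSort n (fun i => seq.getD i 0 / 2 ^ (L - l)) (fun i => seq.getD i 0)
            (s'.mem 2 0)) W D := fun l => by
        by_cases hl : l < L
        · obtain ⟨f, o, h1, h2, -⟩ := hP l hl
          exact ⟨o.work, o.depth, fun _ => ⟨f, o, h1, h2, le_rfl, le_rfl⟩⟩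
        · exact ⟨0, 0, fun h => absurd h hl⟩
      choose W D hWD using hex
      exact ⟨(Finset.range L).sup W, (Finset.range L).sup D, fun l hl => (hWD l hl).mono
        (fun _ h => h) (Finset.le_sup (Finset.mem_range.2 hl))
        (Finset.le_sup (Finset.mem_range.2 hl)), fun h => absurd h hn₀⟩
  obtain ⟨f, o, h1, h2, h3, h4⟩ := runs_sortWT hn hσ hσn hL rfl hw' hseq fun l hl _ => hruns l hl
  refine ⟨f, o, h1, h2, fun hn₀ => ?_⟩
  obtain ⟨hWs, hDs⟩ := hbound hn₀
  have hn4 : 4 ≤ n := le_trans (le_max_right _ _) hn₀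
  obtain ⟨h2y, h1z⟩ := hyz hn4
  have hLσ : (L : ℝ) ≤ 2 * Real.logb 2 σ := hL ▸ clog_le_two_mul_logb hσ
  have ht : (Nat.clog 2 n : ℝ) ≤ 2 * y := clog_le_two_mul_logb (by omega)
  have hLt : (L : ℝ) ≤ Nat.clog 2 n := by
    rw [← hL]
    exact_mod_cast Nat.clog_mono_right 2 hσn
  have hL1 : (1 : ℝ) ≤ L := by
    rw [← hL]
    exact_mod_cast Nat.clog_pos (b := 2) (by norm_num) hσ
  have hn1 : (4 : ℝ) ≤ n := by exact_mod_cast hn4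
  have hX : (n : ℝ) ≤ n * z := le_mul_of_one_le_right (by linarith) h1z
  constructor
  · have h3' : (o.work : ℝ) ≤ 12 * (L + 1) + (2 + L * (1 + (400 * n + Ws))) := by
      exact_mod_cast h3
    calc (o.work : ℝ) ≤ 12 * (L + 1) + (2 + L * (1 + (400 * n + Ws))) := h3'
      _ ≤ L * (27 + 400 * n + Ws) := by linarith
      _ ≤ L * ((1000 + C₁) * (n * z)) := by
        refine mul_le_mul_of_nonneg_left ?_ (by linarith)
        linarith
      _ ≤ (2 * Real.logb 2 σ) * ((1000 + C₁) * (n * z)) :=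
        mul_le_mul_of_nonneg_right hLσ (by positivity)
      _ = (2000 + 2 * C₁) * (n * z * Real.logb 2 σ) := by ring
  · have h4' : (o.depth : ℝ) ≤ 12 * (L + 1) + (3 + (400 * (Nat.clog 2 n + 1) + Ds)) := by
      exact_mod_cast h4
    have : 0 ≤ C₁ * y := by positivity
    linarith

end WorkDepth

theorem mainTheorem4 (P : WorkDepth.Cmd) (w : ℕ → ℕ) (hw : ∀ n, 4 * (Nat.log 2 n + 1) ≤ w n) :
    ((∃ (C : ℝ) (n₀ : ℕ), ∀ (n : ℕ) (key val : ℕ → ℕ), (∀ i < n, key i < n ∧ val i < n) →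
        ∀ ω : ℕ → Fin (2 ^ w n), WorkDepth.SortsWithin (w n) ω P C n₀ n key val) →
      ∃ (C : ℝ) (n₀ : ℕ), ∀ (σ : ℕ) (S : List ℕ), 2 ≤ σ → σ ≤ S.length → (∀ c ∈ S, c < σ) →
        ∀ ω : ℕ → Fin (2 ^ w S.length),
          WorkDepth.BuildsWithin (w S.length) ω P C n₀ S σ) ∧
    (∀ δ : ℕ → ENNReal,
      (∃ (C : ℝ) (n₀ : ℕ), ∀ (n : ℕ) (key val : ℕ → ℕ), (∀ i < n, key i < n ∧ val i < n) →
        WorkDepth.tape (w n) {ω | ¬ WorkDepth.SortsWithin (w n) ω P C n₀ n key val} ≤ δ n) →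
      ∃ (C : ℝ) (n₀ : ℕ), ∀ (σ : ℕ) (S : List ℕ), 2 ≤ σ → σ ≤ S.length → (∀ c ∈ S, c < σ) →
        WorkDepth.tape (w S.length)
            {ω | ¬ WorkDepth.BuildsWithin (w S.length) ω P C n₀ S σ} ≤
          Nat.clog 2 σ * δ S.length) := by
  have hkeys : ∀ (σ : ℕ) (S : List ℕ) (k : ℕ), σ ≤ S.length → (∀ c ∈ S, c < σ) →
      ∀ i < S.length, S.getD i 0 / 2 ^ k < S.length ∧ S.getD i 0 < S.length :=
    fun σ S k hσ hS i hi => by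
      have h := (hS _ (WorkDepth.getD_mem hi)).trans_le hσ
      exact ⟨(Nat.div_le_self _ _).trans_lt h, h⟩
  constructor
  · rintro ⟨C, n₀, h⟩
    exact ⟨2000 + 2 * max C 0, max n₀ 4, fun σ S hσ hσn hS ω =>
      WorkDepth.buildsWithin_of_sortsWithin (hw _) hσ hσn hS fun l _ =>
        h _ _ _ (hkeys σ S _ hσn hS) ω⟩
  · rintro δ ⟨C, n₀, h⟩
    refine ⟨2000 + 2 * max C 0, max n₀ 4, fun σ S hσ hσn hS => ?_⟩
    set bad : ℕ → Set (ℕ → Fin (2 ^ w S.length)) := fun l =>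
      {ω | ¬ WorkDepth.SortsWithin (w S.length) ω P C n₀ S.length
        (fun i => S.getD i 0 / 2 ^ (Nat.clog 2 σ - l)) fun i => S.getD i 0} with hbad
    calc _ ≤ WorkDepth.tape (w S.length) (⋃ l ∈ Finset.range (Nat.clog 2 σ), bad l) := by
          refine measure_mono fun ω hω => ?_
          by_contra hne
          simp only [hbad, Set.mem_iUnion, Finset.mem_range, Set.mem_ofPred_eq, not_exists,
            not_not] at hne
          exact hω (WorkDepth.buildsWithin_of_sortsWithin (hw _) hσ hσn hS hne)
      _ ≤ ∑ l ∈ Finset.range (Nat.clog 2 σ), WorkDepth.tape (w S.length) (bad l) :=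
          measure_biUnion_finset_le _ _
      _ ≤ ∑ l ∈ Finset.range (Nat.clog 2 σ), δ S.length :=
          Finset.sum_le_sum fun l _ => h _ _ _ (hkeys σ S _ hσn hS)
      _ = Nat.clog 2 σ * δ S.length := by simp
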